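/- Let $n\ge 11$ be an integer and let $k,l\ge 0$, $p,q\ge 1$ be real numbers with $pq>1$. Put $Q(\lambda)=\lambda(n-2-\lambda)$ and $$\alpha=\frac{k+2+(l+2)p}{pq-1},\qquad \beta=\frac{l+2+(k+2)q}{pq-1}.$$ Assume the existence condition $$\frac{k+n}{p+1}+\frac{l+n}{q+1}\le n-2$$ and the Joseph-Lundgren condition $$\left[\frac{(n-2)^2-(\alpha-\beta)^2}{4}\right]^2\ \ge\ pq\,Q(\alpha)Q(\beta).\tag{JL}$$ The first condition implies $Q(\alpha),Q(\beta)>0$; let $C_\alpha,C_\beta>0$ be defined by $C_\alpha^{pq-1}=Q(\alpha)Q(\beta)^p$ and $C_\beta^{pq-1}=Q(\beta)Q(\alpha)^q$. Let $$F(\lambda)=Q(\alpha-\lambda)Q(\beta-\lambda)-pq\,Q(\alpha)Q(\beta).$$ Then $F$ has a largest negative root, which we denote by $-\gamma$ (so $\gamma>0$), and every regular positive radial solution $(u,v)$, i.e. every pair of positive radial functions $u,v\in C^2(\mathbb R^n)$, written as functions of $r=|x|$, with $$-\Delta u=|x|^k v^p,\qquad -\Delta v=|x|^l u^q\qquad\text{in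 }\mathbb R^n,$$ has the following asymptotic behavior. (a) If strict inequality holds in (JL), then there exist constants $D_1,D_2\in\mathbb R$ such that, as $r\to\infty$, $$u(r)=C_\alpha r^{-\alpha}+D_1r^{-\alpha-\gamma}+o(r^{-\alpha-\gamma}),\qquad v(r)=C_\beta r^{-\beta}+D_2r^{-\beta-\gamma}+o(r^{-\beta-\gamma}).$$ (b) If equality holds in (JL), then there exist constants $D_1,D_2\in\mathbb R$ such that, as $r\to\infty$, $$u(r)=C_\alpha r^{-\alpha}+D_1r^{-\alpha-\gamma}\log r+o(r^{-\alpha-\gamma}\log r),\qquad v(r)=C_\beta r^{-\beta}+D_2r^{-\beta-\gamma}\log r+o(r^{-\beta-\gamma}\log r).$$ -/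

import Mathlib

open Filter Asymptotics

namespace HenonLaneEmden

noncomputable section

/-- The quadratic `Q(t) = t (n - 2 - t)`. -/
def Q (n : ℕ) (t : ℝ) : ℝ := t * ((n : ℝ) - 2 - t)

/-- The exponent `α = (k + 2 + (l + 2) p) / (p q - 1)`. -/
def alpha (k l p q : ℝ) : ℝ := (k + 2 + (l + 2) * p) / (p * q - 1)

/-- The exponent `β = (l + 2 + (k + 2) q) / (p q - 1)`. -/
def beta (k l p q : ℝ) : ℝ := (l + 2 + (k + 2) * q) / (p * q - 1)

/-- The coefficient `C_α`, given by `C_α ^ (p q - 1) = Q(α) Q(β) ^ p`; it is the positive root when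
`Q(α), Q(β) > 0`, which holds under the existence condition. -/
def Calpha (n : ℕ) (k l p q : ℝ) : ℝ :=
  (Q n (alpha k l p q) * Q n (beta k l p q) ^ p) ^ (1 / (p * q - 1))

/-- The coefficient `C_β`, given by `C_β ^ (p q - 1) = Q(β) Q(α) ^ q`. -/
def Cbeta (n : ℕ) (k l p q : ℝ) : ℝ :=
  (Q n (beta k l p q) * Q n (alpha k l p q) ^ q) ^ (1 / (p * q - 1))

/-- The condition for the existence of regular positive radial solutions. -/
def ExistenceCondition (n : ℕ) (k l p q : ℝ) : Prop :=
  (k + n) / (p + 1) + (l + n) / (q + 1) ≤ (n : ℝ) - 2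

/-- Left-hand side of the Joseph-Lundgren condition. -/
def jlLeft (n : ℕ) (k l p q : ℝ) : ℝ :=
  ((((n : ℝ) - 2) ^ 2 - (alpha k l p q - beta k l p q) ^ 2) / 4) ^ 2

/-- Right-hand side of the Joseph-Lundgren condition. -/
def jlRight (n : ℕ) (k l p q : ℝ) : ℝ :=
  p * q * Q n (alpha k l p q) * Q n (beta k l p q)

/-- The characteristic polynomial `F(t) = Q(α - t) Q(β - t) - p q Q(α) Q(β)`. -/
def charF (n : ℕ) (k l p q t : ℝ) : ℝ :=
  Q n (alpha k l p q - t) * Q n (beta k l p q - t)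
    - p * q * Q n (alpha k l p q) * Q n (beta k l p q)

/-- `(u, v)` is a regular (that is, classical, twice continuously differentiable on all of `ℝⁿ`)
positive solution of `-Δu = |x|^k v^p`, `-Δv = |x|^l u^q` in `ℝⁿ`. -/
structure IsRegularPositiveSolution (n : ℕ) (k l p q : ℝ)
    (u v : EuclideanSpace ℝ (Fin n) → ℝ) : Prop where
  contDiff_u : ContDiff ℝ 2 u
  contDiff_v : ContDiff ℝ 2 v
  pos_u : ∀ x, 0 < u x
  pos_v : ∀ x, 0 < v x
  eq_u : ∀ x, -(Laplacian.laplacian u x) = ‖x‖ ^ k * v x ^ p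
  eq_v : ∀ x, -(Laplacian.laplacian v x) = ‖x‖ ^ l * u x ^ q

/-- `u, v` are the profiles (as functions of `r = |x| ≥ 0`) of a regular positive radial
solution. -/
def IsRegularPositiveRadialSolution (n : ℕ) (k l p q : ℝ) (u v : ℝ → ℝ) : Prop :=
  IsRegularPositiveSolution n k l p q (fun x => u ‖x‖) (fun x => v ‖x‖)

end

end HenonLaneEmden

open HenonLaneEmden

/-! Write `N = n - 2`. In the variable `t = log r` the functions `X = r^α u / C_α` and `Y = r^β v /
C_β` solve an autonomous system with equilibrium `(1, 1)`, the singular solution. The linearisation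
there has characteristic polynomial `F`, whose roots are symmetric about `-s`, with `s = (N - α - β)
/ 2`. The Joseph-Lundgren condition says exactly that `F(-s) ≥ 0`, equivalently that a positive
multiple of `e^{-st}` in each component is a supersolution of the linearised system.

This supersolution drives two comparison arguments, both through `false_of_cooperative`. By
convexity of powers, `(1 - X, 1 - Y)` is a subsolution of the linearised system, which leads to `X,
Y < 1` (`X_lt_one`). Once this is known, `(X', Y')` is a subsolution too, which leads to `X', Y' >
0` (`X₁_pos`). Hence `X` and `Y` converge, and the limit can only be `(1, 1)` (`tendsto_X_one`).

For the rate, the deviations `a = 1 - X` and `b = 1 - Y` solve the linearised system up to a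
quadratic error. Left eigenvectors split it into one unstable and three stable components. The
unstable one is governed by the future of the error and, as `a` and `b` decrease, is quadratically
small. A Lyapunov function gives the stable ones a preliminary decay faster than `e^{-γt/2}`, so the
quadratic error is integrable against `e^{γt}` and the leading coefficient converges
(`IsQuadraticallyPerturbed.exists_tendsto`). When equality holds in the condition, `-γ` is a double
root, and the resulting Jordan block produces the factor `t = log r`. -/

open Topology

/-! ### Reduction of the Laplacian to the radial profile -/

/-- The product of the variable with a function continuous at `0` has derivative there the value
of that function. -/
lemma hasDerivAt_id_mul_zero {h : ℝ → ℝ} (hh : ContinuousAt h 0) :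
    HasDerivAt (fun s => s * h s) (h 0) 0 := by
  rw [hasDerivAt_iff_tendsto_slope]
  refine (hh.tendsto.mono_left nhdsWithin_le_nhds).congr' ?_
  filter_upwards [self_mem_nhdsWithin] with s hs
  have hs' : s ≠ 0 := hs
  simp [slope_def_field, hs']

lemma hasDerivAt_sqrt_sq_add_sq {r : ℝ} (hr : 0 < r) (s : ℝ) :
    HasDerivAt (fun s : ℝ => √(r ^ 2 + s ^ 2)) (s / √(r ^ 2 + s ^ 2)) s := by
  have h1 : HasDerivAt (fun s : ℝ => r ^ 2 + s ^ 2) (2 * s) s := by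
    simpa using (hasDerivAt_pow 2 s).const_add (r ^ 2)
  have h2 := h1.sqrt (by positivity)
  convert h2 using 1
  field_simp

section Radial

variable {E : Type*} [NormedAddCommGroup E] [InnerProductSpace ℝ E]

lemma hasDerivAt_line {f : E → ℝ} (hf : ContDiff ℝ 2 f) (x e : E) (s : ℝ) :
    HasDerivAt (fun s : ℝ => f (x + s • e)) (fderiv ℝ f (x + s • e) e) s := by
  have h1 : HasDerivAt (fun s : ℝ => x + s • e) e s := by
    simpa using ((hasDerivAt_id s).smul_const e).const_add x
  exact ((hf.differentiable (by norm_num)) _).hasFDerivAt.comp_hasDerivAt s h1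

lemma hasDerivAt_fderiv_line {f : E → ℝ} (hf : ContDiff ℝ 2 f) (x e : E) (s : ℝ) :
    HasDerivAt (fun s : ℝ => fderiv ℝ f (x + s • e) e)
      (fderiv ℝ (fderiv ℝ f) (x + s • e) e e) s := by
  have h1 : HasDerivAt (fun s : ℝ => x + s • e) e s := by
    simpa using ((hasDerivAt_id s).smul_const e).const_add x
  have h2 : ContDiff ℝ 1 (fderiv ℝ f) := hf.fderiv_right (by norm_num)
  have h3 := ((h2.differentiable (by norm_num)) (x + s • e)).hasFDerivAt.comp_hasDerivAt s h1
  exact h3.clm_apply (hasDerivAt_const s e) |>.congr_deriv (by simp)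

lemma norm_smul_add_smul_of_orthonormal {e e' : E} (he : ‖e‖ = 1) (he' : ‖e'‖ = 1)
    (hee : inner ℝ e e' = 0) (r s : ℝ) : ‖r • e + s • e'‖ = √(r ^ 2 + s ^ 2) := by
  rw [eq_comm, Real.sqrt_eq_iff_mul_self_eq (by positivity) (norm_nonneg _),
    norm_add_mul_self_real, inner_smul_left, inner_smul_right, hee, norm_smul, norm_smul, he, he']
  simp only [Real.norm_eq_abs, mul_one, abs_mul_abs_self, mul_zero]
  ring

/-- A radial function of class `C²` has a twice differentiable profile, in terms of which its
Laplacian takes the usual form. -/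
lemma exists_radial_profile_derivs {n : ℕ} (hn : 0 < n) {u : ℝ → ℝ}
    (hu : ContDiff ℝ 2 (fun x : EuclideanSpace ℝ (Fin n) => u ‖x‖)) :
    ∃ u₁ u₂ : ℝ → ℝ, ∃ e : EuclideanSpace ℝ (Fin n), ‖e‖ = 1 ∧
      (∀ r, 0 < r → HasDerivAt u (u₁ r) r) ∧ (∀ r, 0 < r → HasDerivAt u₁ (u₂ r) r) ∧
      (∀ r, 0 < r → Laplacian.laplacian (fun x : EuclideanSpace ℝ (Fin n) => u ‖x‖) (r • e)
        = u₂ r + (n - 1) / r * u₁ r) ∧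
      Tendsto u (𝓝[>] 0) (𝓝 (u 0)) ∧ Tendsto (fun r => r * u₁ r) (𝓝[>] 0) (𝓝 0) := by
  set f := fun x : EuclideanSpace ℝ (Fin n) => u ‖x‖ with hf
  let b := EuclideanSpace.basisFun (Fin n) ℝ
  let i₀ : Fin n := ⟨0, hn⟩
  set e := b i₀ with he
  have he1 : ‖e‖ = 1 := b.orthonormal.1 i₀
  have hd1 : ∀ r, HasDerivAt (fun s : ℝ => f (s • e)) (fderiv ℝ f (r • e) e) r := fun r => by
    simpa using hasDerivAt_line hu 0 e r
  have hd2 : ∀ r, HasDerivAt (fun s : ℝ => fderiv ℝ f (s • e) e)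
      (fderiv ℝ (fderiv ℝ f) (r • e) e e) r := fun r => by
    simpa using hasDerivAt_fderiv_line hu 0 e r
  have hfu : ∀ s : ℝ, 0 ≤ s → f (s • e) = u s := fun s hs => by
    simp [hf, norm_smul, he1, abs_of_nonneg hs]
  have hu1 : ∀ r, 0 < r → HasDerivAt u (fderiv ℝ f (r • e) e) r := fun r hr => by
    refine (hd1 r).congr_of_eventuallyEq ?_
    filter_upwards [lt_mem_nhds hr] with s hs using (hfu s hs.le).symm
  refine ⟨fun r => fderiv ℝ f (r • e) e, fun r => fderiv ℝ (fderiv ℝ f) (r • e) e e, e, he1,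
    hu1, fun r _ => hd2 r, fun r hr => ?_, ?_, ?_⟩
  · rw [InnerProductSpace.laplacian_eq_iteratedFDeriv_orthonormalBasis f b]
    simp only [iteratedFDeriv_two_apply, Matrix.cons_val_zero, Matrix.cons_val_one]
    rw [← Finset.add_sum_erase _ _ (Finset.mem_univ i₀)]
    congr 1
    have key : ∀ i ∈ Finset.univ.erase i₀, fderiv ℝ (fderiv ℝ f) (r • e) (b i) (b i)
        = fderiv ℝ f (r • e) e / r := by
      intro i hi
      have hne : i₀ ≠ i := (Finset.ne_of_mem_erase hi).symm
      have hnorm := norm_smul_add_smul_of_orthonormal he1 (b.orthonormal.1 i)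
        (b.orthonormal.2 hne) r
      have hq : ∀ s, 0 < √(r ^ 2 + s ^ 2) := fun s => by positivity
      -- Along a line tangent to the sphere the first derivative is `s` times a continuous function,
      -- so its derivative at `s = 0` is the value `u'(r) / r` of that function; no third derivative
      -- is needed.
      have h1 : ∀ s, fderiv ℝ f (r • e + s • b i) (b i)
          = s * (fderiv ℝ f (√(r ^ 2 + s ^ 2) • e) e / √(r ^ 2 + s ^ 2)) := by
        intro s
        have h2 := hasDerivAt_line hu (r • e) (b i) s
        have h3 : HasDerivAt (fun s : ℝ => u (√(r ^ 2 + s ^ 2))) _ s :=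
          (hu1 _ (hq s)).comp s (hasDerivAt_sqrt_sq_add_sq hr s)
        have h4 : (fun s : ℝ => f (r • e + s • b i)) = fun s => u (√(r ^ 2 + s ^ 2)) := by
          funext s; simp only [hf, hnorm]
        change HasDerivAt (fun s : ℝ => f (r • e + s • b i)) _ s at h2
        rw [h4] at h2
        rw [h2.unique h3]; ring
      have h5 := hasDerivAt_fderiv_line hu (r • e) (b i) 0
      change HasDerivAt (fun s : ℝ => fderiv ℝ f (r • e + s • b i) (b i)) _ 0 at h5
      simp only [h1] at h5
      have hc : Continuous fun s : ℝ => fderiv ℝ f (s • e) e :=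
        continuous_iff_continuousAt.2 fun s => (hd2 s).continuousAt
      have hs : Continuous fun s : ℝ => √(r ^ 2 + s ^ 2) := by fun_prop
      have h6 := hasDerivAt_id_mul_zero (h := fun s : ℝ =>
        fderiv ℝ f (√(r ^ 2 + s ^ 2) • e) e / √(r ^ 2 + s ^ 2))
        ((hc.comp hs).div hs fun s => (hq s).ne').continuousAt
      have h7 := h5.unique h6
      simpa [hr.le] using h7
    rw [Finset.sum_congr rfl key, Finset.sum_const, Finset.card_erase_of_mem (Finset.mem_univ _),
      Finset.card_univ, Fintype.card_fin, nsmul_eq_mul, Nat.cast_sub hn]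
    push_cast
    ring
  · have h := ((hd1 0).continuousAt.tendsto).mono_left (nhdsWithin_le_nhds (s := Set.Ioi 0))
    rw [hfu 0 le_rfl] at h
    refine h.congr' ?_
    filter_upwards [self_mem_nhdsWithin] with s hs using hfu s (le_of_lt hs)
  · have h : ContinuousAt (fun r : ℝ => r * fderiv ℝ f (r • e) e) 0 :=
      continuousAt_id.mul (hd2 0).continuousAt
    simpa [ContinuousAt] using h.tendsto.mono_left (nhdsWithin_le_nhds (s := Set.Ioi 0))

end Radial

/-! ### Maximum principles and comparison on the line -/

lemma antitoneOn_Ici_of_hasDerivAt_nonpos {f f' : ℝ → ℝ} {T : ℝ}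
    (hf : ∀ t, T ≤ t → HasDerivAt f (f' t) t) (hf' : ∀ t, T ≤ t → f' t ≤ 0) :
    AntitoneOn f (Set.Ici T) := by
  refine antitoneOn_of_deriv_nonpos (convex_Ici T)
    (fun t ht => (hf t ht).continuousAt.continuousWithinAt)
    (fun t ht => (hf t (interior_subset ht)).differentiableAt.differentiableWithinAt)
    fun t ht => ?_
  rw [(hf t (interior_subset ht)).deriv]
  exact hf' t (interior_subset ht)

/-- The second order necessary condition at a local maximum. -/
lemma second_deriv_nonpos_of_isLocalMax {f f₁ : ℝ → ℝ} {d x : ℝ}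
    (hf : ∀ t, HasDerivAt f (f₁ t) t) (hf₁ : HasDerivAt f₁ d x) (h : IsLocalMax f x) :
    f₁ x = 0 ∧ d ≤ 0 := by
  have h0 : f₁ x = 0 := h.hasDerivAt_eq_zero (hf x)
  refine ⟨h0, ?_⟩
  by_contra! hd
  have h1 : deriv f = f₁ := funext fun t => (hf t).deriv
  -- A positive second derivative would make `x` a local minimum as well, hence `f` locally constant
  -- and `d = 0`.
  have h2 : IsLocalMin f x := by
    refine isLocalMin_of_deriv_deriv_pos ?_ ?_ (hf x).continuousAt
    · rw [h1, hf₁.deriv]; exact hd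
    · rw [h1, h0]
  have h3 : ∀ᶠ t in 𝓝 x, f t = f x := by
    filter_upwards [h, h2] with t ha hb using le_antisymm ha hb
  have h4 : ∀ᶠ t in 𝓝 x, f₁ t = 0 := by
    filter_upwards [h3.eventually_nhds] with t ht
    exact ((hf t).congr_of_eventuallyEq
      (f₁ := fun _ => f x) (by filter_upwards [ht] with s hs using hs.symm)).unique
        (hasDerivAt_const t (f x))
  have h5 : HasDerivAt (fun _ : ℝ => (0 : ℝ)) d x :=
    hf₁.congr_of_eventuallyEq (by filter_upwards [h4] with t ht using ht.symm)
  exact hd.ne' (h5.unique (hasDerivAt_const x 0))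

/-- A function which is negative near `-∞` and has no nonnegative local maxima stays away from `0`
at `+∞` once it has become nonnegative. -/
lemma eventually_ge_of_no_nonneg_max {f f₁ f₂ : ℝ → ℝ} (hf : ∀ t, HasDerivAt f (f₁ t) t)
    (hf₁ : ∀ t, HasDerivAt f₁ (f₂ t) t) (hpos : ∀ t, 0 ≤ f t → f₁ t = 0 → 0 < f₂ t)
    (hbot : ∀ᶠ t in atBot, f t < 0) {T : ℝ} (hT : 0 ≤ f T) :
    ∃ ε > 0, ∀ᶠ t in atTop, ε ≤ f t := by
  have hmax : ∀ t, 0 ≤ f t → ¬ IsLocalMax f t := fun t ht hm => by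
    obtain ⟨h1, h2⟩ := second_deriv_nonpos_of_isLocalMax hf (hf₁ t) hm
    exact (hpos t ht h1).not_ge h2
  have hcont : Continuous f := continuous_iff_continuousAt.2 fun t => (hf t).continuousAt
  -- A drop after a nonnegative value, together with a negative value far to the left, would force
  -- an interior nonnegative maximum.
  have hmono : ∀ t₁ t₂, t₁ < t₂ → 0 ≤ f t₁ → f t₁ ≤ f t₂ := by
    intro t₁ t₂ h12 h0
    by_contra! hlt
    obtain ⟨s, hs, hst⟩ := (hbot.and (eventually_lt_atBot t₁)).exists
    obtain ⟨t₀, ht₀, hM⟩ := isCompact_Icc.exists_isMaxOn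
      (Set.nonempty_Icc.2 (hst.trans h12).le) (hcont.continuousOn (s := Set.Icc s t₂))
    have h01 : f t₁ ≤ f t₀ := hM ⟨hst.le, h12.le⟩
    have hs0 : s ≠ t₀ := by rintro rfl; linarith
    have h20 : t₀ ≠ t₂ := by rintro rfl; linarith
    exact hmax t₀ (h0.trans h01) (hM.isLocalMax
      (Icc_mem_nhds (lt_of_le_of_ne ht₀.1 hs0) (lt_of_le_of_ne ht₀.2 h20)))
  have hnn : ∀ t, T ≤ t → 0 ≤ f t := fun t ht => by
    rcases ht.eq_or_lt with rfl | h
    · exact hT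
    · exact hT.trans (hmono T t h hT)
  -- Otherwise `f` vanishes on a whole interval, and each of its points is a nonnegative local
  -- maximum.
  have h1 : 0 < f (T + 1) := by
    by_contra! h1
    have hz : ∀ t ∈ Set.Ioo T (T + 1), f t = 0 := fun t ht =>
      le_antisymm ((hmono t (T + 1) ht.2 (hnn t ht.1.le)).trans h1) (hnn t ht.1.le)
    have hmem : T + 1 / 2 ∈ Set.Ioo T (T + 1) := ⟨by linarith, by linarith⟩
    refine hmax (T + 1 / 2) (hz _ hmem).ge ?_
    filter_upwards [isOpen_Ioo.mem_nhds hmem] with t ht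
    rw [hz t ht, hz _ hmem]
  refine ⟨f (T + 1), h1, ?_⟩
  filter_upwards [eventually_gt_atTop (T + 1)] with t ht using hmono _ _ ht h1.le

/-- Integrating once shows that `f₁ + c f` falls at least linearly; since `f` is bounded, `f₁` must
tend to `-∞`, and then so must `f`. -/
lemma false_of_bounded_of_second_order_neg {f f₁ f₂ : ℝ → ℝ} {c ε M : ℝ}
    (hf : ∀ t, HasDerivAt f (f₁ t) t)
    (hf₁ : ∀ t, HasDerivAt f₁ (f₂ t) t) (hε : 0 < ε)
    (h : ∀ᶠ t in atTop, f₂ t + c * f₁ t ≤ -ε) (hb : ∀ᶠ t in atTop, |f t| ≤ M) : False := by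
  obtain ⟨T, hTT⟩ := eventually_atTop.1 (h.and hb)
  have hT := fun t ht => (hTT t ht).1
  have hb := fun t ht => (hTT t ht).2
  have hanti : AntitoneOn (fun t => f₁ t + c * f t + ε * t) (Set.Ici T) := by
    refine antitoneOn_Ici_of_hasDerivAt_nonpos (f' := fun t => f₂ t + c * f₁ t + ε * 1)
      (fun t _ => ?_) (fun t ht => by linarith [hT t ht])
    exact ((hf₁ t).add ((hf t).const_mul c)).add ((hasDerivAt_id t).const_mul ε)
  set C := f₁ T + c * f T + ε * T + |c| * M
  have h1 : ∀ t, T ≤ t → f₁ t ≤ C - ε * t := fun t ht => by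
    have h2 := hanti Set.self_mem_Ici ht ht
    have h3 : -(c * f t) ≤ |c| * M := by
      refine (neg_le_abs _).trans ?_
      rw [abs_mul]; gcongr; exact hb t ht
    simp only at h2
    linarith
  set T' := max T ((C + 1) / ε)
  have h2 : ∀ t, T' ≤ t → f₁ t ≤ -1 := fun t ht => by
    have h3 := h1 t ((le_max_left _ _).trans ht)
    have h4 := (le_max_right _ _).trans ht
    rw [div_le_iff₀ hε] at h4
    linarith
  have hanti' : AntitoneOn (fun t => f t + t) (Set.Ici T') :=
    antitoneOn_Ici_of_hasDerivAt_nonpos (f' := fun t => f₁ t + 1)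
      (fun t _ => (hf t).add (hasDerivAt_id t)) (fun t ht => by linarith [h2 t ht])
  have hM : 0 ≤ M := (abs_nonneg _).trans (hb T le_rfl)
  have h5 : T' ≤ T' + (2 * M + 1) := by linarith
  have h6 := hanti' Set.self_mem_Ici (Set.mem_Ici.2 h5) h5
  have h7 := abs_le.1 (hb T' (le_max_left _ _))
  have h8 := abs_le.1 (hb (T' + (2 * M + 1)) ((le_max_left _ _).trans h5))
  simp only at h6
  linarith

/-- Differential inequality satisfied where a function touches a multiple of an exponential from
below. -/
lemma le_of_touches_exp {a a₁ a₂ : ℝ → ℝ} (ha : ∀ t, HasDerivAt a (a₁ t) t)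
    (ha₁ : ∀ t, HasDerivAt a₁ (a₂ t) t) {c D t₀ c₁ K₁ : ℝ}
    (hle : ∀ᶠ t in 𝓝 t₀, a t ≤ D * Real.exp (c * t)) (heq : a t₀ = D * Real.exp (c * t₀)) :
    (K₁ - c₁ * c - c ^ 2) * (D * Real.exp (c * t₀)) ≤ -a₂ t₀ - c₁ * a₁ t₀ + K₁ * a t₀ := by
  have he : ∀ t : ℝ, HasDerivAt (fun t => Real.exp (c * t)) (c * Real.exp (c * t)) t := fun t => by
    have h := ((hasDerivAt_id t).const_mul c).exp
    simpa [mul_comm] using h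
  have h1 : ∀ t, HasDerivAt (fun t => a t - D * Real.exp (c * t))
      (a₁ t - D * (c * Real.exp (c * t))) t := fun t => (ha t).sub ((he t).const_mul D)
  have h2 : HasDerivAt (fun t => a₁ t - D * (c * Real.exp (c * t)))
      (a₂ t₀ - D * (c * (c * Real.exp (c * t₀)))) t₀ :=
    (ha₁ t₀).sub (((he t₀).const_mul c).const_mul D)
  have h3 : IsLocalMax (fun t => a t - D * Real.exp (c * t)) t₀ := by
    filter_upwards [hle] with t ht
    rw [heq]; linarith
  obtain ⟨h4, h5⟩ := second_deriv_nonpos_of_isLocalMax h1 h2 h3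
  have h6 : a₁ t₀ = c * (D * Real.exp (c * t₀)) := by linarith
  rw [h6, heq]
  linarith

lemma exists_isLocalMax_of_tendsto_atBot_zero {φ : ℝ → ℝ} {T : ℝ} (hφ : Continuous φ)
    (hbot : Tendsto φ atBot (𝓝 0)) (hpos : ∃ s ≤ T, 0 < φ s) (hT : φ T ≤ 0) :
    ∃ t₀, IsLocalMax φ t₀ ∧ 0 < φ t₀ := by
  obtain ⟨s, hsT, hs⟩ := hpos
  obtain ⟨s₀, h0, hs₀⟩ := ((hbot.eventually (gt_mem_nhds hs)).and (eventually_lt_atBot s)).exists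
  obtain ⟨t₀, ht₀, hM⟩ := isCompact_Icc.exists_isMaxOn
      (Set.nonempty_Icc.2 (hs₀.le.trans hsT)) (hφ.continuousOn (s := Set.Icc s₀ T))
  have h01 : φ s ≤ φ t₀ := hM ⟨hs₀.le, hsT⟩
  have h1 : s₀ ≠ t₀ := by rintro rfl; linarith
  have h2 : t₀ ≠ T := by rintro rfl; linarith
  exact ⟨t₀, hM.isLocalMax (Icc_mem_nhds (lt_of_le_of_ne ht₀.1 h1) (lt_of_le_of_ne ht₀.2 h2)),
    by linarith⟩

/-- Comparison for a cooperative pair of second order differential inequalities having an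
exponential supersolution: the two components cannot both be nonpositive at the same time. -/
lemma false_of_cooperative {a a₁ a₂ b b₁ b₂ : ℝ → ℝ}
    (ha : ∀ t, HasDerivAt a (a₁ t) t) (ha₁ : ∀ t, HasDerivAt a₁ (a₂ t) t)
    (hb : ∀ t, HasDerivAt b (b₁ t) t) (hb₁ : ∀ t, HasDerivAt b₁ (b₂ t) t)
    {c₁ c₂ K₁ K₂ κ₁ κ₂ c A B La Lb T : ℝ} (hc : c < 0) (hA : 0 < A) (hB : 0 < B)
    (hκ₁ : 0 < κ₁) (hκ₂ : 0 < κ₂)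
    (hsA : κ₁ * B ≤ (K₁ - c₁ * c - c ^ 2) * A) (hsB : κ₂ * A ≤ (K₂ - c₂ * c - c ^ 2) * B)
    (hia : ∀ t, -a₂ t - c₁ * a₁ t + K₁ * a t ≤ κ₁ * max (b t) 0)
    (hib : ∀ t, -b₂ t - c₂ * b₁ t + K₂ * b t ≤ κ₂ * max (a t) 0)
    (hstrict : ∀ t, 0 < a t → 0 < b t →
      -a₂ t - c₁ * a₁ t + K₁ * a t < κ₁ * b t ∨ -b₂ t - c₂ * b₁ t + K₂ * b t < κ₂ * a t)
    (hLa : Tendsto a atBot (𝓝 La)) (hLb : Tendsto b atBot (𝓝 Lb))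
    (hpos : ∀ᶠ t in atBot, 0 < a t) (haT : a T ≤ 0) (hbT : b T ≤ 0) : False := by
  have hexp : Tendsto (fun t : ℝ => Real.exp (-c * t)) atBot (𝓝 0) :=
    Real.tendsto_exp_atBot.comp (tendsto_id.const_mul_atBot (neg_pos.2 hc))
  -- The pointwise least multiple of the supersolution `(A, B) e^{ct}` that dominates `(a, b)`. It
  -- vanishes at `-∞` because `c < 0`, so it attains a positive interior local maximum `M`, where `M
  -- (A, B) e^{ct}` touches `(a, b)` from above.
  let φ : ℝ → ℝ := fun t => max (a t * Real.exp (-c * t) / A) (b t * Real.exp (-c * t) / B)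
  have hca : Continuous a := continuous_iff_continuousAt.2 fun t => (ha t).continuousAt
  have hcb : Continuous b := continuous_iff_continuousAt.2 fun t => (hb t).continuousAt
  have hφ : Continuous φ := by fun_prop
  have hφ0 : Tendsto φ atBot (𝓝 0) := by
    have h := ((hLa.mul hexp).div_const A).max ((hLb.mul hexp).div_const B)
    simpa only [mul_zero, zero_div, max_self] using h
  have hφs : ∃ s ≤ T, 0 < φ s := by
    obtain ⟨s, h1, h2⟩ := (hpos.and (eventually_le_atBot T)).exists
    exact ⟨s, h2, lt_max_of_lt_left (by positivity)⟩
  have hφT : φ T ≤ 0 := by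
    refine max_le ?_ ?_
    · exact div_nonpos_of_nonpos_of_nonneg
        (mul_nonpos_of_nonpos_of_nonneg haT (Real.exp_pos _).le) hA.le
    · exact div_nonpos_of_nonpos_of_nonneg
        (mul_nonpos_of_nonpos_of_nonneg hbT (Real.exp_pos _).le) hB.le
  obtain ⟨t₀, hmax, hM⟩ := exists_isLocalMax_of_tendsto_atBot_zero hφ hφ0 hφs hφT
  set M := φ t₀ with hMdef
  have hee : ∀ t : ℝ, Real.exp (-c * t) * Real.exp (c * t) = 1 := fun t => by
    rw [← Real.exp_add]; simp
  have hle : ∀ {x D : ℝ}, 0 < D → ∀ t : ℝ, (x * Real.exp (-c * t) / D ≤ M ↔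
      x ≤ M * D * Real.exp (c * t)) := by
    intro x D hD t
    rw [div_le_iff₀ hD]
    have h0 := Real.exp_pos (c * t)
    rw [← mul_le_mul_iff_left₀ h0, mul_assoc, hee, mul_one]
  have hea : ∀ᶠ t in 𝓝 t₀, a t ≤ M * A * Real.exp (c * t) := by
    filter_upwards [hmax] with t ht using (hle hA t).1 ((le_max_left _ _).trans ht)
  have heb : ∀ᶠ t in 𝓝 t₀, b t ≤ M * B * Real.exp (c * t) := by
    filter_upwards [hmax] with t ht using (hle hB t).1 ((le_max_right _ _).trans ht)
  have ha0 := hea.self_of_nhds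
  have hb0 := heb.self_of_nhds
  set e := Real.exp (c * t₀) with he
  have hepos : 0 < e := Real.exp_pos _
  have hMe : 0 < M * e := mul_pos hM hepos
  have hcase : a t₀ = M * A * e ∨ b t₀ = M * B * e := by
    rcases max_choice (a t₀ * Real.exp (-c * t₀) / A) (b t₀ * Real.exp (-c * t₀) / B) with h | h
    · left
      have : M = a t₀ * Real.exp (-c * t₀) / A := h
      rw [this, div_mul_cancel₀ _ hA.ne', mul_assoc, hee, mul_one]
    · right
      have : M = b t₀ * Real.exp (-c * t₀) / B := h
      rw [this, div_mul_cancel₀ _ hB.ne', mul_assoc, hee, mul_one]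
  have hta : a t₀ = M * A * e → κ₁ * (M * B * e) ≤ -a₂ t₀ - c₁ * a₁ t₀ + K₁ * a t₀ := fun h => by
    have h1 := le_of_touches_exp ha ha₁ (c₁ := c₁) (K₁ := K₁) hea h
    nlinarith
  have htb : b t₀ = M * B * e → κ₂ * (M * A * e) ≤ -b₂ t₀ - c₂ * b₁ t₀ + K₂ * b t₀ := fun h => by
    have h1 := le_of_touches_exp hb hb₁ (c₁ := c₂) (K₁ := K₂) heb h
    nlinarith
  have hAe : 0 < M * A * e := by positivity
  have hBe : 0 < M * B * e := by positivity
  -- Contact in one component propagates to the other through the coupling, so both touch and the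
  -- strict inequality can be applied.
  have hab : a t₀ = M * A * e → b t₀ = M * B * e := fun h => by
    refine le_antisymm hb0 ?_
    have h1 := (hta h).trans (hia t₀)
    have h2 := le_of_mul_le_mul_left h1 hκ₁
    rcases le_max_iff.1 h2 with h3 | h3 <;> linarith
  have hba : b t₀ = M * B * e → a t₀ = M * A * e := fun h => by
    refine le_antisymm ha0 ?_
    have h1 := (htb h).trans (hib t₀)
    have h2 := le_of_mul_le_mul_left h1 hκ₂
    rcases le_max_iff.1 h2 with h3 | h3 <;> linarith
  have hboth : a t₀ = M * A * e ∧ b t₀ = M * B * e := by tauto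
  rcases hstrict t₀ (by linarith) (by linarith) with h | h
  · have := hta hboth.1
    rw [hboth.2] at h; linarith
  · have := htb hboth.2
    rw [hboth.1] at h; linarith

/-! ### The Emden-Fowler system: bounds, monotonicity and convergence -/

/-- Conditions on the exponents `α, β, p, q` in dimension `N + 2`. -/
structure Supercritical (N α β p q : ℝ) : Prop where
  pos_α : 0 < α
  pos_β : 0 < β
  add_le : α + β ≤ N
  one_le_p : 1 ≤ p
  one_le_q : 1 ≤ q
  one_lt_mul : 1 < p * q
  jl : p * q * (α * (N - α)) * (β * (N - β)) ≤ ((N ^ 2 - (α - β) ^ 2) / 4) ^ 2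

/-- The autonomous system obtained by the Emden-Fowler change of variables from a regular positive
radial solution, normalised so that the singular solution becomes `X = Y = 1`. -/
structure IsEmdenFowler (N α β p q : ℝ) (X Y X₁ Y₁ : ℝ → ℝ) : Prop where
  deriv_X : ∀ t, HasDerivAt X (X₁ t) t
  deriv_Y : ∀ t, HasDerivAt Y (Y₁ t) t
  deriv_X₁ : ∀ t, HasDerivAt X₁ (-(N - 2 * α) * X₁ t + α * (N - α) * (X t - Y t ^ p)) t
  deriv_Y₁ : ∀ t, HasDerivAt Y₁ (-(N - 2 * β) * Y₁ t + β * (N - β) * (Y t - X t ^ q)) t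
  pos_X : ∀ t, 0 < X t
  pos_Y : ∀ t, 0 < Y t
  tendsto_X : Tendsto X atBot (𝓝 0)
  tendsto_Y : Tendsto Y atBot (𝓝 0)
  tendsto_X₁ : Tendsto X₁ atBot (𝓝 0)
  tendsto_Y₁ : Tendsto Y₁ atBot (𝓝 0)
  pos_X₁ : ∀ᶠ t in atBot, 0 < X₁ t
  pos_Y₁ : ∀ᶠ t in atBot, 0 < Y₁ t

namespace Supercritical

variable {N α β p q : ℝ}

lemma symm (h : Supercritical N α β p q) : Supercritical N β α q p where
  pos_α := h.pos_β
  pos_β := h.pos_α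
  add_le := by linarith [h.add_le]
  one_le_p := h.one_le_q
  one_le_q := h.one_le_p
  one_lt_mul := by linarith [h.one_lt_mul, mul_comm p q]
  jl := by nlinarith [h.jl]

lemma lt_α (h : Supercritical N α β p q) : 0 < N - α := by
  linarith [h.add_le, h.pos_β]

lemma Kα_pos (h : Supercritical N α β p q) : 0 < α * (N - α) := mul_pos h.pos_α h.lt_α

lemma Kβ_pos (h : Supercritical N α β p q) : 0 < β * (N - β) := h.symm.Kα_pos

lemma p_pos (h : Supercritical N α β p q) : 0 < p := zero_lt_one.trans_le h.one_le_p

lemma q_pos (h : Supercritical N α β p q) : 0 < q := h.symm.p_pos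

lemma base_pos (h : Supercritical N α β p q) : 0 < (N ^ 2 - (α - β) ^ 2) / 4 := by
  nlinarith [h.add_le, h.pos_α, h.pos_β]

/-- The critical exponent of the linearised problem lies strictly below the middle of the
characteristic roots. -/
lemma add_lt (h : Supercritical N α β p q) : α + β < N := by
  refine lt_of_le_of_ne h.add_le fun he => ?_
  have h1 := h.jl
  have h2 : (N ^ 2 - (α - β) ^ 2) / 4 = α * β := by rw [← he]; ring
  have h3 : N - α = β := by linarith
  have h4 : N - β = α := by linarith
  rw [h2, h3, h4] at h1
  have h5 : 0 < (α * β) ^ 2 := pow_pos (mul_pos h.pos_α h.pos_β) 2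
  nlinarith [h.one_lt_mul]

/-- Comparison of a pair of functions with the positive decaying supersolution of the linearised
system. -/
lemma false_of_cooperative (h : Supercritical N α β p q) {a a₁ a₂ b b₁ b₂ : ℝ → ℝ}
    (ha : ∀ t, HasDerivAt a (a₁ t) t) (ha₁ : ∀ t, HasDerivAt a₁ (a₂ t) t)
    (hb : ∀ t, HasDerivAt b (b₁ t) t) (hb₁ : ∀ t, HasDerivAt b₁ (b₂ t) t) {La Lb T : ℝ}
    (hia : ∀ t, -a₂ t - (N - 2 * α) * a₁ t + α * (N - α) * a t
      ≤ p * (α * (N - α)) * max (b t) 0)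
    (hib : ∀ t, -b₂ t - (N - 2 * β) * b₁ t + β * (N - β) * b t
      ≤ q * (β * (N - β)) * max (a t) 0)
    (hsa : ∀ t, 1 < p → 0 < b t →
      -a₂ t - (N - 2 * α) * a₁ t + α * (N - α) * a t < p * (α * (N - α)) * b t)
    (hsb : ∀ t, 1 < q → 0 < a t →
      -b₂ t - (N - 2 * β) * b₁ t + β * (N - β) * b t < q * (β * (N - β)) * a t)
    (hLa : Tendsto a atBot (𝓝 La)) (hLb : Tendsto b atBot (𝓝 Lb))
    (hpos : ∀ᶠ t in atBot, 0 < a t) (haT : a T ≤ 0) (hbT : b T ≤ 0) : False := by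
  -- The rate is the centre of symmetry of the characteristic roots. There both factors of the
  -- characteristic polynomial equal `B`; the first supersolution inequality is then an identity and
  -- the second is the Joseph-Lundgren condition.
  refine _root_.false_of_cooperative ha ha₁ hb hb₁ (c := (α + β - N) / 2)
    (A := p * (α * (N - α))) (B := (N ^ 2 - (α - β) ^ 2) / 4)
    (by linarith [h.add_lt]) (mul_pos h.p_pos h.Kα_pos) h.base_pos
    (mul_pos h.p_pos h.Kα_pos) (mul_pos h.q_pos h.Kβ_pos) (le_of_eq (by ring)) ?_ hia hib
    (fun t hat hbt => ?_) hLa hLb hpos haT hbT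
  · have := h.jl
    calc _ = p * q * (α * (N - α)) * (β * (N - β)) := by ring
      _ ≤ _ := this
      _ = _ := by ring
  -- Since `p q > 1`, at least one nonlinearity is strictly convex. This supplies strictness even if
  -- equality holds in the Joseph-Lundgren condition.
  · by_cases hp : 1 < p
    · exact Or.inl (hsa t hp hbt)
    · refine Or.inr (hsb t ?_ hat)
      have : p = 1 := le_antisymm (not_lt.1 hp) h.one_le_p
      simpa [this] using h.one_lt_mul

end Supercritical

lemma one_sub_rpow_le {p y : ℝ} (hp : 1 ≤ p) (hy : 0 < y) : 1 - y ^ p ≤ p * (1 - y) := by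
  have := one_add_mul_self_le_rpow_one_add (s := y - 1) (by linarith) hp
  rw [add_sub_cancel] at this
  linarith

lemma one_sub_rpow_lt {p y : ℝ} (hp : 1 < p) (hy : 0 < y) (hy1 : y ≠ 1) :
    1 - y ^ p < p * (1 - y) := by
  have := one_add_mul_self_lt_rpow_one_add (s := y - 1) (by linarith) (sub_ne_zero.2 hy1) hp
  rw [add_sub_cancel] at this
  linarith

namespace IsEmdenFowler

variable {N α β p q : ℝ} {X Y X₁ Y₁ : ℝ → ℝ}

lemma symm (h : IsEmdenFowler N α β p q X Y X₁ Y₁) : IsEmdenFowler N β α q p Y X Y₁ X₁ :=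
  ⟨h.deriv_Y, h.deriv_X, h.deriv_Y₁, h.deriv_X₁, h.pos_Y, h.pos_X, h.tendsto_Y, h.tendsto_X,
    h.tendsto_Y₁, h.tendsto_X₁, h.pos_Y₁, h.pos_X₁⟩

/-- Bernoulli's inequality `1 - y^p ≤ p (1 - y)` makes `(1 - X, 1 - Y)` a subsolution of the
linearisation at the equilibrium, and it is positive near `-∞`. -/
lemma not_both_ge_one (h : IsEmdenFowler N α β p q X Y X₁ Y₁) (hs : Supercritical N α β p q)
    (T : ℝ) (hX : 1 ≤ X T) (hY : 1 ≤ Y T) : False := by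
  refine hs.false_of_cooperative (a := fun t => 1 - X t) (b := fun t => 1 - Y t)
    (fun t => (h.deriv_X t).const_sub 1) (fun t => (h.deriv_X₁ t).neg)
    (fun t => (h.deriv_Y t).const_sub 1) (fun t => (h.deriv_Y₁ t).neg) (T := T)
    (fun t => ?_) (fun t => ?_) (fun t hp ht => ?_) (fun t hq ht => ?_)
    (h.tendsto_X.const_sub 1) (h.tendsto_Y.const_sub 1) ?_ (by linarith) (by linarith)
  · have h1 := one_sub_rpow_le hs.one_le_p (h.pos_Y t)
    have h2 : p * (1 - Y t) ≤ p * max (1 - Y t) 0 :=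
      mul_le_mul_of_nonneg_left (le_max_left _ _) hs.p_pos.le
    nlinarith [hs.Kα_pos]
  · have h1 := one_sub_rpow_le hs.one_le_q (h.pos_X t)
    have h2 : q * (1 - X t) ≤ q * max (1 - X t) 0 :=
      mul_le_mul_of_nonneg_left (le_max_left _ _) hs.q_pos.le
    nlinarith [hs.Kβ_pos]
  · have h1 := one_sub_rpow_lt hp (h.pos_Y t) (by linarith)
    nlinarith [hs.Kα_pos]
  · have h1 := one_sub_rpow_lt hq (h.pos_X t) (by linarith)
    nlinarith [hs.Kβ_pos]
  · filter_upwards [h.tendsto_X.eventually (gt_mem_nhds zero_lt_one)] with t ht using by linarith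

/-- A regular solution stays below the singular one. -/
lemma X_lt_one (h : IsEmdenFowler N α β p q X Y X₁ Y₁) (hs : Supercritical N α β p q)
    (T : ℝ) : X T < 1 := by
  by_contra! hT
  have hY : ∀ t, 1 ≤ X t → Y t < 1 := fun t ht => by
    by_contra! hy
    exact h.not_both_ge_one hs t ht hy
  have hbot : ∀ᶠ t in atBot, X t - 1 < 0 := by
    filter_upwards [h.tendsto_X.eventually (gt_mem_nhds zero_lt_one)] with t ht using by linarith
  -- While `X ≥ 1` one has `Y < 1`, so the equation for `X` excludes a maximum and `X` stays above
  -- `1 + ε`. This forces a uniformly negative right-hand side in the equation for the bounded `Y`.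
  obtain ⟨ε, hε, hev⟩ := eventually_ge_of_no_nonneg_max (f := fun t => X t - 1)
    (fun t => (h.deriv_X t).sub_const 1) h.deriv_X₁ (fun t ht ht1 => by
      have h1 := hY t (by linarith)
      have h2 : Y t ^ p < 1 := Real.rpow_lt_one (h.pos_Y t).le h1 hs.p_pos
      rw [ht1]
      nlinarith [hs.Kα_pos]) hbot (T := T) (by linarith)
  refine false_of_bounded_of_second_order_neg (c := N - 2 * β) (M := 1)
    h.deriv_Y h.deriv_Y₁ (ε := β * (N - β) * ε) (mul_pos hs.Kβ_pos hε) ?_ ?_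
  · filter_upwards [hev] with t ht
    have h1 := hY t (by linarith)
    have h2 : X t ≤ X t ^ q := Real.self_le_rpow_of_one_le (by linarith) hs.one_le_q
    nlinarith [hs.Kβ_pos]
  · filter_upwards [hev] with t ht
    rw [abs_of_pos (h.pos_Y t)]
    exact (hY t (by linarith)).le

lemma Y_lt_one (h : IsEmdenFowler N α β p q X Y X₁ Y₁) (hs : Supercritical N α β p q)
    (T : ℝ) : Y T < 1 := h.symm.X_lt_one hs.symm T

lemma deriv_X₂ (h : IsEmdenFowler N α β p q X Y X₁ Y₁) (t : ℝ) :
    HasDerivAt (fun t => -(N - 2 * α) * X₁ t + α * (N - α) * (X t - Y t ^ p))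
      (-(N - 2 * α) * (-(N - 2 * α) * X₁ t + α * (N - α) * (X t - Y t ^ p))
        + α * (N - α) * (X₁ t - p * Y t ^ (p - 1) * Y₁ t)) t := by
  have h1 := (h.deriv_Y t).rpow_const (p := p) (Or.inl (h.pos_Y t).ne')
  refine ((h.deriv_X₁ t).const_mul _).add (((h.deriv_X t).sub h1).const_mul _)
    |>.congr_deriv (by ring)

lemma rpow_mul_le_max (h : IsEmdenFowler N α β p q X Y X₁ Y₁) (hs : Supercritical N α β p q)
    (t : ℝ) : Y t ^ (p - 1) * Y₁ t ≤ max (Y₁ t) 0 := by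
  have h0 : 0 ≤ Y t ^ (p - 1) := Real.rpow_nonneg (h.pos_Y t).le _
  have h1 : Y t ^ (p - 1) ≤ 1 :=
    Real.rpow_le_one (h.pos_Y t).le (h.Y_lt_one hs t).le (by linarith [hs.one_le_p])
  have h2 := le_max_left (Y₁ t) 0
  have h3 := le_max_right (Y₁ t) 0
  nlinarith

lemma rpow_mul_lt (h : IsEmdenFowler N α β p q X Y X₁ Y₁) (hs : Supercritical N α β p q)
    (t : ℝ) (hp : 1 < p) (ht : 0 < Y₁ t) : Y t ^ (p - 1) * Y₁ t < Y₁ t := by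
  have h1 : Y t ^ (p - 1) < 1 :=
    Real.rpow_lt_one (h.pos_Y t).le (h.Y_lt_one hs t) (by linarith)
  nlinarith

/-- The system is autonomous, so `(X₁, Y₁)` solves the linearisation along the solution. Its
coupling coefficients carry the factors `Y^(p-1)` and `X^(q-1)`, which are at most `1` because `X, Y
< 1`; the comparison at the equilibrium therefore applies. -/
lemma not_both_nonincreasing (h : IsEmdenFowler N α β p q X Y X₁ Y₁)
    (hs : Supercritical N α β p q) (T : ℝ) (hX : X₁ T ≤ 0) (hY : Y₁ T ≤ 0) : False := by
  have hpα := mul_pos hs.p_pos hs.Kα_pos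
  have hqβ := mul_pos hs.q_pos hs.Kβ_pos
  refine hs.false_of_cooperative h.deriv_X₁ h.deriv_X₂ h.deriv_Y₁ h.symm.deriv_X₂
    (T := T) (fun t => ?_) (fun t => ?_) (fun t hp ht => ?_) (fun t hq ht => ?_)
    h.tendsto_X₁ h.tendsto_Y₁ h.pos_X₁ hX hY
  · nlinarith [h.rpow_mul_le_max hs t]
  · nlinarith [h.symm.rpow_mul_le_max hs.symm t]
  · nlinarith [h.rpow_mul_lt hs t hp ht]
  · nlinarith [h.symm.rpow_mul_lt hs.symm t hq ht]

/-- A regular solution, rescaled by the singular one, is strictly increasing. -/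
lemma X₁_pos (h : IsEmdenFowler N α β p q X Y X₁ Y₁) (hs : Supercritical N α β p q)
    (T : ℝ) : 0 < X₁ T := by
  by_contra! hT
  have hY : ∀ t, X₁ t ≤ 0 → 0 < Y₁ t := fun t ht => by
    by_contra! hy
    exact h.not_both_nonincreasing hs t ht hy
  -- If `X₁` were once nonpositive, it would eventually be at most `-ε`, which is impossible for
  -- positive `X`.
  obtain ⟨ε, hε, hev⟩ := eventually_ge_of_no_nonneg_max (f := fun t => -X₁ t)
    (fun t => (h.deriv_X₁ t).neg) (fun t => (h.deriv_X₂ t).neg) (fun t ht ht1 => by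
      have h1 := hY t (by linarith)
      have h2 : 0 < p * Y t ^ (p - 1) * Y₁ t :=
        mul_pos (mul_pos hs.p_pos (Real.rpow_pos_of_pos (h.pos_Y t) _)) h1
      have h3 := mul_pos hs.Kα_pos h2
      have h4 := mul_nonneg hs.Kα_pos.le ht
      have h5 : -(N - 2 * α) * X₁ t + α * (N - α) * (X t - Y t ^ p) = 0 := by linarith
      rw [h5]
      linarith)
    (by filter_upwards [h.pos_X₁] with t ht using by linarith) (T := T) (by linarith)
  obtain ⟨T', hT'⟩ := eventually_atTop.1 hev
  have hanti : AntitoneOn (fun t => X t + ε * t) (Set.Ici T') :=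
    antitoneOn_Ici_of_hasDerivAt_nonpos (f' := fun t => X₁ t + ε * 1)
      (fun t _ => (h.deriv_X t).add ((hasDerivAt_id t).const_mul ε))
      (fun t ht => by linarith [hT' t ht])
  have h1 : T' ≤ T' + 1 / ε := by have := div_pos one_pos hε; linarith
  have h2 := hanti Set.self_mem_Ici h1 h1
  simp only [mul_add, mul_one_div_cancel hε.ne'] at h2
  linarith [h.pos_X (T' + 1 / ε), h.X_lt_one hs T']

lemma strictMono_X (h : IsEmdenFowler N α β p q X Y X₁ Y₁) (hs : Supercritical N α β p q) :
    StrictMono X :=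
  strictMono_of_hasDerivAt_pos h.deriv_X (h.X₁_pos hs)

lemma exists_limit_X (h : IsEmdenFowler N α β p q X Y X₁ Y₁) (hs : Supercritical N α β p q) :
    ∃ L, 0 < L ∧ L ≤ 1 ∧ Tendsto X atTop (𝓝 L) := by
  have hb : BddAbove (Set.range X) := ⟨1, by rintro _ ⟨t, rfl⟩; exact (h.X_lt_one hs t).le⟩
  refine ⟨⨆ t, X t, (h.pos_X 0).trans_le (le_ciSup hb 0), ciSup_le fun t => (h.X_lt_one hs t).le,
    tendsto_atTop_ciSup (h.strictMono_X hs).monotone hb⟩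

/-- If the limits did not balance, `X'' + (N - 2α) X'` would eventually keep a sign and stay away
from `0`, contradicting boundedness of `X`. -/
lemma limit_X_eq (h : IsEmdenFowler N α β p q X Y X₁ Y₁) (hs : Supercritical N α β p q)
    {L L' : ℝ} (hL : Tendsto X atTop (𝓝 L)) (hL' : Tendsto Y atTop (𝓝 L')) : L = L' ^ p := by
  have hlim : Tendsto (fun t => α * (N - α) * (X t - Y t ^ p)) atTop
      (𝓝 (α * (N - α) * (L - L' ^ p))) :=
    (hL.sub (hL'.rpow_const (Or.inr hs.p_pos.le))).const_mul _
  by_contra hne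
  rcases lt_or_gt_of_ne hne with hlt | hgt
  · have h1 : α * (N - α) * (L - L' ^ p) < 0 := by nlinarith [hs.Kα_pos]
    refine false_of_bounded_of_second_order_neg (c := N - 2 * α) (M := 1) h.deriv_X h.deriv_X₁
      (ε := -(α * (N - α) * (L - L' ^ p)) / 2) (by linarith) ?_ ?_
    · filter_upwards [hlim.eventually (gt_mem_nhds (show α * (N - α) * (L - L' ^ p) <
        α * (N - α) * (L - L' ^ p) / 2 by linarith))] with t ht
      linarith
    · exact Eventually.of_forall fun t => by
        rw [abs_of_pos (h.pos_X t)]; exact (h.X_lt_one hs t).le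
  · have h1 : 0 < α * (N - α) * (L - L' ^ p) := by nlinarith [hs.Kα_pos]
    refine false_of_bounded_of_second_order_neg (f := fun t => -X t) (c := N - 2 * α) (M := 1)
      (fun t => (h.deriv_X t).neg) (fun t => (h.deriv_X₁ t).neg)
      (ε := (α * (N - α) * (L - L' ^ p)) / 2) (by linarith) ?_ ?_
    · filter_upwards [hlim.eventually (lt_mem_nhds (show α * (N - α) * (L - L' ^ p) / 2 <
        α * (N - α) * (L - L' ^ p) by linarith))] with t ht
      linarith
    · exact Eventually.of_forall fun t => by
        rw [abs_neg, abs_of_pos (h.pos_X t)]; exact (h.X_lt_one hs t).le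

/-- A regular solution is asymptotic to the singular one. -/
lemma tendsto_X_one (h : IsEmdenFowler N α β p q X Y X₁ Y₁) (hs : Supercritical N α β p q) :
    Tendsto X atTop (𝓝 1) := by
  obtain ⟨L, hL0, hL1, hL⟩ := h.exists_limit_X hs
  obtain ⟨L', hL'0, -, hL'⟩ := h.symm.exists_limit_X hs.symm
  have h1 := h.limit_X_eq hs hL hL'
  have h2 := h.symm.limit_X_eq hs.symm hL' hL
  have h3 : L = L ^ (q * p) := by rw [Real.rpow_mul hL0.le, ← h2, ← h1]
  have h4 : L = 1 := by
    by_contra hne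
    have h5 := Real.rpow_lt_rpow_of_exponent_gt hL0 (lt_of_le_of_ne hL1 hne) hs.symm.one_lt_mul
    rw [Real.rpow_one] at h5
    linarith
  rwa [h4] at hL

lemma tendsto_Y_one (h : IsEmdenFowler N α β p q X Y X₁ Y₁) (hs : Supercritical N α β p q) :
    Tendsto Y atTop (𝓝 1) := h.symm.tendsto_X_one hs.symm

/-- The logarithmic derivative of `X` is at most `α`, since the original solution decreases. -/
lemma X₁_le (h : IsEmdenFowler N α β p q X Y X₁ Y₁) (hs : Supercritical N α β p q)
    (T : ℝ) : X₁ T ≤ α * X T := by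
  -- Up to a constant this is the flux `r^{n-1} u'(r)`, whose derivative is minus the source term.
  let f : ℝ → ℝ := fun t => (X₁ t - α * X t) * Real.exp ((N - α) * t)
  have hf : ∀ t, HasDerivAt f (-(α * (N - α) * Y t ^ p) * Real.exp ((N - α) * t)) t := fun t => by
    have h1 := ((hasDerivAt_id t).const_mul (N - α)).exp
    refine (((h.deriv_X₁ t).sub ((h.deriv_X t).const_mul α)).mul h1).congr_deriv ?_
    simp only [id, Pi.sub_apply]
    ring
  have hanti : Antitone f := antitone_of_hasDerivAt_nonpos hf fun t => by
    have h1 := Real.rpow_pos_of_pos (h.pos_Y t) p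
    have h2 := mul_pos (mul_pos hs.Kα_pos h1) (Real.exp_pos ((N - α) * t))
    simp only [Pi.zero_apply]
    linarith
  have hlim : Tendsto f atBot (𝓝 0) := by
    have h1 : Tendsto (fun t : ℝ => Real.exp ((N - α) * t)) atBot (𝓝 0) :=
      Real.tendsto_exp_atBot.comp (tendsto_id.const_mul_atBot hs.lt_α)
    have h2 := (h.tendsto_X₁.sub (h.tendsto_X.const_mul α)).mul h1
    simpa using h2
  have h0 : f T ≤ 0 := hanti.ge_of_tendsto hlim T
  have h1 := nonpos_of_mul_nonpos_left h0 (Real.exp_pos _)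
  linarith

end IsEmdenFowler

/-! ### Scalar linear equations and decay of triangular systems -/

lemma hasDerivAt_exp_const_mul (κ t : ℝ) :
    HasDerivAt (fun t : ℝ => Real.exp (κ * t)) (κ * Real.exp (κ * t)) t := by
  simpa [mul_comm] using ((hasDerivAt_id t).const_mul κ).exp

lemma tendsto_exp_neg_mul_atTop {κ : ℝ} (hκ : 0 < κ) :
    Tendsto (fun t : ℝ => Real.exp (-κ * t)) atTop (𝓝 0) :=
  Real.tendsto_exp_atBot.comp (tendsto_id.const_mul_atTop_of_neg (neg_neg_of_pos hκ))

lemma exists_tendsto_of_deriv_exp_small {f g : ℝ → ℝ} {C κ : ℝ}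
    (hf : ∀ t, HasDerivAt f (g t) t) (hκ : 0 < κ)
    (hg : ∀ᶠ t in atTop, |g t| ≤ C * Real.exp (-κ * t)) : ∃ D, Tendsto f atTop (𝓝 D) := by
  obtain ⟨T, hT⟩ := eventually_atTop.1 hg
  have hgm : Measurable g := by
    have : g = deriv f := funext fun t => (hf t).deriv.symm
    rw [this]; exact measurable_deriv f
  refine ⟨_, MeasureTheory.tendsto_limUnder_of_hasDerivAt_of_integrableOn_Ioi (a := T)
    (fun t _ => hf t) ?_⟩
  refine ((exp_neg_integrableOn_Ioi T hκ).const_mul C).mono' hgm.aestronglyMeasurable ?_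
  refine (MeasureTheory.ae_restrict_iff' measurableSet_Ioi).2 (Eventually.of_forall fun t ht => ?_)
  exact hT t (le_of_lt ht)

lemma eventually_le_of_damped {f g : ℝ → ℝ} {κ M η : ℝ} (hκ : 0 < κ) (hη : 0 < η)
    (hf : ∀ t, HasDerivAt f (-κ * f t + g t) t) (hg : ∀ᶠ t in atTop, g t ≤ M) :
    ∀ᶠ t in atTop, f t ≤ M / κ + η := by
  obtain ⟨T, hT⟩ := eventually_atTop.1 hg
  have hanti : AntitoneOn (fun t => (f t - M / κ) * Real.exp (κ * t)) (Set.Ici T) := by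
    refine antitoneOn_Ici_of_hasDerivAt_nonpos
      (f' := fun t => (g t - M) * Real.exp (κ * t)) (fun t _ => ?_) (fun t ht => ?_)
    · refine (((hf t).sub_const (M / κ)).mul (hasDerivAt_exp_const_mul κ t)).congr_deriv ?_
      field_simp
      ring
    · exact mul_nonpos_of_nonpos_of_nonneg (by linarith [hT t ht]) (Real.exp_pos _).le
  set C := (f T - M / κ) * Real.exp (κ * T)
  have hlim := (tendsto_exp_neg_mul_atTop hκ).const_mul C
  rw [mul_zero] at hlim
  filter_upwards [hlim.eventually (gt_mem_nhds hη), eventually_ge_atTop T] with t ht htT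
  have h1 : (f t - M / κ) * Real.exp (κ * t) ≤ C := hanti Set.self_mem_Ici htT htT
  have h2 : Real.exp (κ * t) * Real.exp (-κ * t) = 1 := by rw [← Real.exp_add]; simp
  have h3 := mul_le_mul_of_nonneg_right h1 (Real.exp_pos (-κ * t)).le
  rw [mul_assoc, h2, mul_one] at h3
  linarith

/-- A linearly damped equation with convergent forcing has convergent solutions. -/
lemma tendsto_of_damped {f g : ℝ → ℝ} {κ L : ℝ} (hκ : 0 < κ)
    (hf : ∀ t, HasDerivAt f (-κ * f t + g t) t) (hg : Tendsto g atTop (𝓝 L)) :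
    Tendsto f atTop (𝓝 (L / κ)) := by
  rw [tendsto_order]
  constructor
  · intro x hx
    set η := (L / κ - x) / 3 with hηd
    have hη : 0 < η := by linarith
    have h1 : ∀ᶠ t in atTop, -g t ≤ -L + κ * η := by
      filter_upwards [hg.eventually (lt_mem_nhds (show L - κ * η < L by nlinarith))] with t ht
      linarith
    have h2 := eventually_le_of_damped (f := fun t => -f t) (g := fun t => -g t) hκ hη
      (fun t => (hf t).neg.congr_deriv (by ring)) h1
    filter_upwards [h2] with t ht
    rw [add_div, mul_div_cancel_left₀ _ hκ.ne', neg_div] at ht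
    linarith
  · intro x hx
    set η := (x - L / κ) / 3 with hηd
    have hη : 0 < η := by linarith
    have h1 : ∀ᶠ t in atTop, g t ≤ L + κ * η := by
      filter_upwards [hg.eventually (gt_mem_nhds (show L < L + κ * η by nlinarith))] with t ht
      linarith
    have h2 := eventually_le_of_damped hκ hη hf h1
    filter_upwards [h2] with t ht
    rw [add_div, mul_div_cancel_left₀ _ hκ.ne'] at ht
    linarith

lemma eventually_div_id_le_of_deriv_le {f g : ℝ → ℝ} {M η : ℝ} (hη : 0 < η)
    (hf : ∀ t, HasDerivAt f (g t) t) (hg : ∀ᶠ t in atTop, g t ≤ M) :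
    ∀ᶠ t in atTop, f t / t ≤ M + η := by
  obtain ⟨T, hT⟩ := eventually_atTop.1 hg
  have hanti : AntitoneOn (fun t => f t - M * t) (Set.Ici T) :=
    antitoneOn_Ici_of_hasDerivAt_nonpos (f' := fun t => g t - M * 1)
      (fun t _ => (hf t).sub ((hasDerivAt_id t).const_mul M)) (fun t ht => by linarith [hT t ht])
  have hlim : Tendsto (fun t : ℝ => (f T - M * T) / t) atTop (𝓝 0) :=
    tendsto_const_nhds.div_atTop tendsto_id
  filter_upwards [hlim.eventually (gt_mem_nhds hη), eventually_ge_atTop T,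
    eventually_gt_atTop 0] with t ht htT h0
  have h1 : f t - M * t ≤ f T - M * T := hanti Set.self_mem_Ici htT htT
  rw [div_lt_iff₀ h0] at ht
  rw [div_le_iff₀ h0]
  linarith

lemma tendsto_div_id_of_tendsto_deriv {f g : ℝ → ℝ} {L : ℝ}
    (hf : ∀ t, HasDerivAt f (g t) t) (hg : Tendsto g atTop (𝓝 L)) :
    Tendsto (fun t => f t / t) atTop (𝓝 L) := by
  rw [tendsto_order]
  constructor
  · intro x hx
    set η := (L - x) / 3 with hηd
    have hη : 0 < η := by linarith
    have h1 : ∀ᶠ t in atTop, -g t ≤ -L + η := by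
      filter_upwards [hg.eventually (lt_mem_nhds (show L - η < L by linarith))] with t ht
      linarith
    filter_upwards [eventually_div_id_le_of_deriv_le (f := fun t => -f t) hη
      (fun t => (hf t).neg) h1] with t ht
    rw [neg_div] at ht
    linarith
  · intro x hx
    set η := (x - L) / 3 with hηd
    have hη : 0 < η := by linarith
    have h1 : ∀ᶠ t in atTop, g t ≤ L + η := by
      filter_upwards [hg.eventually (gt_mem_nhds (show L < L + η by linarith))] with t ht
      linarith
    filter_upwards [eventually_div_id_le_of_deriv_le hη hf h1] with t ht
    linarith

/-- A bounded solution of an unstable linear equation is controlled by the future forcing. -/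
lemma neg_div_le_of_unstable {Z n : ℝ → ℝ} {l K M T : ℝ} (hl : 0 < l)
    (hZ : ∀ t, HasDerivAt Z (l * Z t + n t) t) (hb : ∀ t, T ≤ t → |Z t| ≤ M)
    (hn : ∀ t, T ≤ t → n t ≤ K) : -(K / l) ≤ Z T := by
  have hanti : AntitoneOn (fun t => (Z t + K / l) * Real.exp (-l * t)) (Set.Ici T) := by
    refine antitoneOn_Ici_of_hasDerivAt_nonpos
      (f' := fun t => (n t - K) * Real.exp (-l * t)) (fun t _ => ?_) (fun t ht => ?_)
    · refine (((hZ t).add_const (K / l)).mul (hasDerivAt_exp_const_mul (-l) t)).congr_deriv ?_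
      field_simp
      ring
    · exact mul_nonpos_of_nonpos_of_nonneg (by linarith [hn t ht]) (Real.exp_pos _).le
  -- Boundedness of `Z` excludes the growing mode `e^{lt}`; comparison is made with the value at
  -- `+∞`.
  have hlim : Tendsto (fun t => (Z t + K / l) * Real.exp (-l * t)) atTop (𝓝 0) := by
    have h1 := (tendsto_exp_neg_mul_atTop hl).const_mul (M + |K / l|)
    rw [mul_zero] at h1
    refine squeeze_zero_norm' ?_ h1
    filter_upwards [eventually_ge_atTop T] with t ht
    rw [norm_mul, Real.norm_eq_abs, Real.norm_eq_abs, abs_of_pos (Real.exp_pos _)]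
    gcongr
    exact (abs_add_le _ _).trans (by gcongr; exact hb t ht)
  have h0 : 0 ≤ (Z T + K / l) * Real.exp (-l * T) := by
    refine le_of_tendsto hlim ?_
    filter_upwards [eventually_ge_atTop T] with t ht using hanti Set.self_mem_Ici ht ht
  have h1 := nonneg_of_mul_nonneg_left h0 (Real.exp_pos _)
  linarith

lemma abs_le_of_unstable {Z n : ℝ → ℝ} {l K M T : ℝ} (hl : 0 < l)
    (hZ : ∀ t, HasDerivAt Z (l * Z t + n t) t) (hb : ∀ t, T ≤ t → |Z t| ≤ M)
    (hn : ∀ t, T ≤ t → |n t| ≤ K) : |Z T| ≤ K / l := by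
  rw [abs_le]
  refine ⟨neg_div_le_of_unstable hl hZ hb fun t ht => (abs_le.1 (hn t ht)).2, ?_⟩
  have h := neg_div_le_of_unstable (Z := fun t => -Z t) (n := fun t => -n t) (K := K) hl
    (fun t => (hZ t).neg.congr_deriv (by ring)) (fun t ht => by rw [abs_neg]; exact hb t ht)
    (fun t ht => by linarith [(abs_le.1 (hn t ht)).1])
  linarith

lemma eventually_le_exp_of_deriv_le {S S' : ℝ → ℝ} {ρ : ℝ} (hS : ∀ t, HasDerivAt S (S' t) t)
    (h : ∀ᶠ t in atTop, S' t ≤ -ρ * S t) :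
    ∃ C, 0 < C ∧ ∀ᶠ t in atTop, S t ≤ C * Real.exp (-ρ * t) := by
  obtain ⟨T, hT⟩ := eventually_atTop.1 h
  have hanti : AntitoneOn (fun t => S t * Real.exp (ρ * t)) (Set.Ici T) := by
    refine antitoneOn_Ici_of_hasDerivAt_nonpos
      (f' := fun t => (S' t + ρ * S t) * Real.exp (ρ * t)) (fun t _ => ?_) (fun t ht => ?_)
    · exact ((hS t).mul (hasDerivAt_exp_const_mul ρ t)).congr_deriv (by ring)
    · exact mul_nonpos_of_nonpos_of_nonneg (by linarith [hT t ht]) (Real.exp_pos _).le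
  refine ⟨|S T * Real.exp (ρ * T)| + 1, by positivity, ?_⟩
  filter_upwards [eventually_ge_atTop T] with t ht
  have h1 : S t * Real.exp (ρ * t) ≤ S T * Real.exp (ρ * T) := hanti Set.self_mem_Ici ht ht
  have h2 : Real.exp (ρ * t) * Real.exp (-ρ * t) = 1 := by rw [← Real.exp_add]; simp
  calc S t = S t * Real.exp (ρ * t) * Real.exp (-ρ * t) := by rw [mul_assoc, h2, mul_one]
    _ ≤ _ := by
      gcongr
      linarith [le_abs_self (S T * Real.exp (ρ * T))]

/-- Exponential decay for a stable triangular system with relatively small perturbation. -/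
lemma triangular_decay {Z V W nZ nV nW : ℝ → ℝ} {γ l₃ l₄ : ℝ} (hγ : 0 < γ)
    (h3 : l₃ ≤ -γ) (h4 : l₄ ≤ -γ)
    (hZ : ∀ t, HasDerivAt Z (-γ * Z t + nZ t) t)
    (hV : ∀ t, HasDerivAt V (l₃ * V t + Z t + nV t) t)
    (hW : ∀ t, HasDerivAt W (l₄ * W t + nW t) t)
    (hsmall : ∀ ν > 0, ∀ᶠ t in atTop, |nZ t| ≤ ν * (|Z t| + |V t| + |W t|) ∧
      |nV t| ≤ ν * (|Z t| + |V t| + |W t|) ∧ |nW t| ≤ ν * (|Z t| + |V t| + |W t|)) :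
    ∃ C, 0 < C ∧ ∀ᶠ t in atTop,
      (|Z t| + |V t| + |W t|) ^ 2 ≤ C * Real.exp (-(3 / 2 * γ) * t) := by
  -- Weighting `V` by `θ` makes its coupling to `Z` cost at most `γ/4` in the energy estimate, even
  -- if `l₃ = -γ`. The errors cost another `γ/4`, so the rate `2γ` of the energy drops only to
  -- `3γ/2`.
  set θ := min 1 (γ / 4) with hθd
  have hθ : 0 < θ := lt_min one_pos (by linarith)
  have hθ1 : θ ≤ 1 := min_le_left _ _
  have hθγ : θ ≤ γ / 4 := min_le_right _ _
  have hS : ∀ t, HasDerivAt (fun t => Z t ^ 2 + (θ * V t) ^ 2 + W t ^ 2)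
      (2 * Z t * (-γ * Z t + nZ t) + 2 * (θ * V t) * (θ * (l₃ * V t + Z t + nV t))
        + 2 * W t * (l₄ * W t + nW t)) t := fun t => by
    refine ((((hZ t).pow 2).add (((hV t).const_mul θ).pow 2)).add ((hW t).pow 2)).congr_deriv ?_
    norm_num
  have habs : ∀ t, |Z t| + |V t| + |W t| ≤ θ⁻¹ * (|Z t| + |θ * V t| + |W t|) := fun t => by
    rw [abs_mul, abs_of_pos hθ, mul_add, mul_add, inv_mul_cancel_left₀ hθ.ne']
    have h1 : 1 ≤ θ⁻¹ := (one_le_inv₀ hθ).2 hθ1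
    have := abs_nonneg (Z t)
    have := abs_nonneg (W t)
    nlinarith
  have hsq : ∀ x y z : ℝ, (|x| + |y| + |z|) ^ 2 ≤ 3 * (x ^ 2 + y ^ 2 + z ^ 2) := fun x y z => by
    rw [← sq_abs x, ← sq_abs y, ← sq_abs z]
    nlinarith [sq_nonneg (|x| - |y|), sq_nonneg (|x| - |z|), sq_nonneg (|y| - |z|)]
  obtain ⟨C, hC, hev⟩ := eventually_le_exp_of_deriv_le (ρ := 3 / 2 * γ) hS (by
    filter_upwards [hsmall (θ * (γ / 24)) (by positivity)] with t ⟨hz, hv, hw⟩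
    have hA := habs t
    set A := |Z t| + |θ * V t| + |W t| with hAd
    have hA0 : 0 ≤ A := by positivity
    have hle : θ * (γ / 24) * (|Z t| + |V t| + |W t|) ≤ γ / 24 * A := by
      calc _ ≤ θ * (γ / 24) * (θ⁻¹ * A) := by gcongr
        _ = _ := by field_simp
    have hz' := hz.trans hle
    have hv' : |θ * nV t| ≤ γ / 24 * A := by
      rw [abs_mul, abs_of_pos hθ]
      calc θ * |nV t| ≤ 1 * |nV t| := by gcongr
        _ ≤ _ := by rw [one_mul]; exact hv.trans hle
    have hw' := hw.trans hle
    have hmul : ∀ {x y : ℝ}, |y| ≤ γ / 24 * A → x * y ≤ |x| * (γ / 24 * A) := fun {x y} h =>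
      (le_abs_self _).trans (by rw [abs_mul]; gcongr)
    have e1 := hmul (x := Z t) hz'
    have e2 := hmul (x := θ * V t) hv'
    have e3 := hmul (x := W t) hw'
    have e4 : (|Z t| + |θ * V t| + |W t|) * (γ / 24 * A)
        ≤ γ / 8 * (Z t ^ 2 + (θ * V t) ^ 2 + W t ^ 2) := by
      have := hsq (Z t) (θ * V t) (W t)
      rw [← hAd] at this ⊢
      nlinarith
    have e5 : 2 * (θ * V t) * (θ * Z t) ≤ γ / 4 * (Z t ^ 2 + (θ * V t) ^ 2) := by
      have h1 : 2 * (θ * V t) * Z t ≤ Z t ^ 2 + (θ * V t) ^ 2 := by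
        nlinarith [sq_nonneg (θ * V t - Z t)]
      have h2 : 0 ≤ Z t ^ 2 + (θ * V t) ^ 2 := by positivity
      nlinarith
    have e6 : l₃ * (θ * V t) ^ 2 ≤ -γ * (θ * V t) ^ 2 := by gcongr
    have e7 : l₄ * W t ^ 2 ≤ -γ * W t ^ 2 := by gcongr
    have e8 : 0 ≤ γ * W t ^ 2 := by positivity
    linarith)
  refine ⟨(θ⁻¹) ^ 2 * (3 * C), by positivity, ?_⟩
  filter_upwards [hev] with t ht
  have h1 : (|Z t| + |V t| + |W t|) ^ 2 ≤ (θ⁻¹ * (|Z t| + |θ * V t| + |W t|)) ^ 2 :=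
    pow_le_pow_left₀ (by positivity) (habs t) 2
  rw [mul_pow] at h1
  have h2 := hsq (Z t) (θ * V t) (W t)
  calc _ ≤ _ := h1
    _ ≤ (θ⁻¹) ^ 2 * (3 * (C * Real.exp (-(3 / 2 * γ) * t))) := by gcongr; linarith
    _ = _ := by ring

/-! ### Diagonalisation and asymptotics of the perturbed linear system -/

/-- A pair of positive decreasing functions tending to `0` which solves a second order linear
system up to a quadratic error. -/
structure IsQuadraticallyPerturbed (c₁ c₂ K₁ K₂ κ₁ κ₂ : ℝ) (a a₁ b b₁ n₁ n₂ : ℝ → ℝ) : Prop where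
  deriv_a : ∀ t, HasDerivAt a (a₁ t) t
  deriv_b : ∀ t, HasDerivAt b (b₁ t) t
  deriv_a₁ : ∀ t, HasDerivAt a₁ (-c₁ * a₁ t + K₁ * a t - κ₁ * b t + n₁ t) t
  deriv_b₁ : ∀ t, HasDerivAt b₁ (-c₂ * b₁ t + K₂ * b t - κ₂ * a t + n₂ t) t
  pos_a : ∀ t, 0 < a t
  pos_b : ∀ t, 0 < b t
  anti_a : Antitone a
  anti_b : Antitone b
  tendsto_a : Tendsto a atTop (𝓝 0)
  tendsto_b : Tendsto b atTop (𝓝 0)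
  bdd_a₁ : ∃ M, ∀ t, |a₁ t| ≤ M
  bdd_b₁ : ∃ M, ∀ t, |b₁ t| ≤ M
  error : ∃ C, 0 ≤ C ∧ ∀ᶠ t in atTop,
    |n₁ t| ≤ C * (a t ^ 2 + b t ^ 2) ∧ |n₂ t| ≤ C * (a t ^ 2 + b t ^ 2)

/-- The functional of `(a, a', b, b')` attached to a number `l`; for a characteristic root it is a
left eigenvector of the linear system. -/
def eigenFunctional (c₁ c₂ K₁ κ₂ l a a₁ b b₁ : ℝ) : ℝ :=
  κ₂ * (a₁ + (l + c₁) * a) + (K₁ - c₁ * l - l ^ 2) * (b₁ + (l + c₂) * b)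

/-- The divided difference of `eigenFunctional` at two points. -/
def eigenFunctionalDiff (c₁ c₂ K₁ κ₂ l l' a b b₁ : ℝ) : ℝ :=
  κ₂ * a - (c₁ + l + l') * (b₁ + (l + c₂) * b) + (K₁ - c₁ * l' - l' ^ 2) * b

/-- The values `a` and `b` are linear combinations of the eigenfunctionals. -/
lemma exists_coeffs_eigenFunctional {c₁ c₂ K₁ κ₂ l₁ l₂ l₃ l₄ : ℝ} (hκ : κ₂ ≠ 0)
    (h12 : l₁ ≠ l₂) (h13 : l₁ ≠ l₃) (h14 : l₁ ≠ l₄) (h42 : l₄ ≠ l₂) (h43 : l₄ ≠ l₃) :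
    ∃ x₁ x₂ x₃ x₄ y₁ y₂ y₃ y₄ : ℝ, ∀ a a₁ b b₁ : ℝ,
      a = x₁ * eigenFunctional c₁ c₂ K₁ κ₂ l₁ a a₁ b b₁
        + x₂ * eigenFunctional c₁ c₂ K₁ κ₂ l₂ a a₁ b b₁
        + x₃ * eigenFunctionalDiff c₁ c₂ K₁ κ₂ l₂ l₃ a b b₁
        + x₄ * eigenFunctional c₁ c₂ K₁ κ₂ l₄ a a₁ b b₁ ∧
      b = y₁ * eigenFunctional c₁ c₂ K₁ κ₂ l₁ a a₁ b b₁
        + y₂ * eigenFunctional c₁ c₂ K₁ κ₂ l₂ a a₁ b b₁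
        + y₃ * eigenFunctionalDiff c₁ c₂ K₁ κ₂ l₂ l₃ a b b₁
        + y₄ * eigenFunctional c₁ c₂ K₁ κ₂ l₄ a a₁ b b₁ := by
  -- Newton interpolation: `eigenFunctional` is a cubic in `l` with leading coefficient `-b`. Second
  -- divided differences based at `l₂, l₃` are affine in `l`; comparing them at `l₁` and `l₄` gives
  -- `b`, and then `a`. Nowhere is `l₂ ≠ l₃` needed.
  obtain ⟨d₁, hd₁⟩ : ∃ d, d * ((l₁ - l₂) * (l₁ - l₃)) = 1 :=
    ⟨_, inv_mul_cancel₀ (mul_ne_zero (sub_ne_zero.2 h12) (sub_ne_zero.2 h13))⟩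
  obtain ⟨d₄, hd₄⟩ : ∃ d, d * ((l₄ - l₂) * (l₄ - l₃)) = 1 :=
    ⟨_, inv_mul_cancel₀ (mul_ne_zero (sub_ne_zero.2 h42) (sub_ne_zero.2 h43))⟩
  obtain ⟨e, he⟩ : ∃ d, d * (l₁ - l₄) = 1 := ⟨_, inv_mul_cancel₀ (sub_ne_zero.2 h14)⟩
  obtain ⟨k, hk⟩ : ∃ d, d * κ₂ = 1 := ⟨_, inv_mul_cancel₀ hκ⟩
  set s := c₁ + l₂ + l₃ with hs
  set r := s * (-(l₁ + l₂ + l₃ + c₁) + l₂) - (K₁ - c₁ * l₃ - l₃ ^ 2) with hr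
  have key : ∀ a a₁ b b₁ : ℝ, ∀ Z₁ Z₂ V Z₄ : ℝ,
      eigenFunctional c₁ c₂ K₁ κ₂ l₁ a a₁ b b₁ = Z₁ →
      eigenFunctional c₁ c₂ K₁ κ₂ l₂ a a₁ b b₁ = Z₂ →
      eigenFunctionalDiff c₁ c₂ K₁ κ₂ l₂ l₃ a b b₁ = V →
      eigenFunctional c₁ c₂ K₁ κ₂ l₄ a a₁ b b₁ = Z₄ →
      a = k * (V - s * (d₁ * (Z₁ - Z₂ - V * (l₁ - l₂))) + r * b) ∧
      b = e * (d₄ * (Z₄ - Z₂ - V * (l₄ - l₂)) - d₁ * (Z₁ - Z₂ - V * (l₁ - l₂))) := by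
    intro a a₁ b b₁ Z₁ Z₂ V Z₄ h1 h2 h3 h4
    have hG : ∀ l d : ℝ, d * ((l - l₂) * (l - l₃)) = 1 →
        d * (eigenFunctional c₁ c₂ K₁ κ₂ l a a₁ b b₁ - Z₂ - V * (l - l₂))
          = -(b₁ + c₂ * b) - c₁ * b - b * (l + l₂ + l₃) := by
      intro l d hd
      rw [← h2, ← h3]
      simp only [eigenFunctional, eigenFunctionalDiff]
      linear_combination (-(b₁ + c₂ * b) - c₁ * b - b * (l + l₂ + l₃)) * hd
    have hG1 := hG l₁ d₁ hd₁
    have hG4 := hG l₄ d₄ hd₄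
    rw [h1] at hG1
    rw [h4] at hG4
    rw [hG1, hG4]
    constructor
    · rw [← h3]
      simp only [eigenFunctionalDiff]
      linear_combination (-a) * hk
    · linear_combination (-b) * he
  refine ⟨k * (-s * d₁ - r * e * d₁), k * (s * d₁ + r * e * (d₁ - d₄)),
    k * (1 + s * d₁ * (l₁ - l₂) + r * e * (d₁ * (l₁ - l₂) - d₄ * (l₄ - l₂))), k * (r * e * d₄),
    -e * d₁, e * (d₁ - d₄), e * (d₁ * (l₁ - l₂) - d₄ * (l₄ - l₂)), e * d₄,
    fun a a₁ b b₁ => ?_⟩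
  obtain ⟨h1, h2⟩ := key a a₁ b b₁ _ _ _ _ rfl rfl rfl rfl
  constructor
  · linear_combination h1 + k * r * h2
  · linear_combination h2

namespace IsQuadraticallyPerturbed

variable {c₁ c₂ K₁ K₂ κ₁ κ₂ : ℝ} {a a₁ b b₁ n₁ n₂ : ℝ → ℝ}

lemma hasDerivAt_eigenFunctional (h : IsQuadraticallyPerturbed c₁ c₂ K₁ K₂ κ₁ κ₂ a a₁ b b₁ n₁ n₂)
    {l : ℝ} (hl : (K₁ - c₁ * l - l ^ 2) * (K₂ - c₂ * l - l ^ 2) = κ₁ * κ₂) (t : ℝ) :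
    HasDerivAt (fun t => eigenFunctional c₁ c₂ K₁ κ₂ l (a t) (a₁ t) (b t) (b₁ t))
      (l * eigenFunctional c₁ c₂ K₁ κ₂ l (a t) (a₁ t) (b t) (b₁ t)
        + (κ₂ * n₁ t + (K₁ - c₁ * l - l ^ 2) * n₂ t)) t := by
  refine ((((h.deriv_a₁ t).add ((h.deriv_a t).const_mul (l + c₁))).const_mul κ₂).add
    (((h.deriv_b₁ t).add ((h.deriv_b t).const_mul (l + c₂))).const_mul
      (K₁ - c₁ * l - l ^ 2))).congr_deriv ?_
  simp only [eigenFunctional]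
  linear_combination (b t) * hl

/-- The condition `hl` is the vanishing of the divided difference of the characteristic polynomial,
which for `l = l'` means a double root. The divided difference of functionals thus treats the
diagonalisable case and the Jordan block alike. -/
lemma hasDerivAt_eigenFunctionalDiff
    (h : IsQuadraticallyPerturbed c₁ c₂ K₁ K₂ κ₁ κ₂ a a₁ b b₁ n₁ n₂)
    {l l' : ℝ} (hl : (c₁ + l + l') * (K₂ - c₂ * l - l ^ 2)
      + (K₁ - c₁ * l' - l' ^ 2) * (c₂ + l + l') = 0) (t : ℝ) :
    HasDerivAt (fun t => eigenFunctionalDiff c₁ c₂ K₁ κ₂ l l' (a t) (b t) (b₁ t))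
      (l' * eigenFunctionalDiff c₁ c₂ K₁ κ₂ l l' (a t) (b t) (b₁ t)
        + eigenFunctional c₁ c₂ K₁ κ₂ l (a t) (a₁ t) (b t) (b₁ t)
        + -(c₁ + l + l') * n₂ t) t := by
  refine ((((h.deriv_a t).const_mul κ₂).sub (((h.deriv_b₁ t).add
    ((h.deriv_b t).const_mul (l + c₂))).const_mul (c₁ + l + l'))).add
      ((h.deriv_b t).const_mul (K₁ - c₁ * l' - l' ^ 2))).congr_deriv ?_
  simp only [eigenFunctional, eigenFunctionalDiff]
  linear_combination (-b t) * hl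

end IsQuadraticallyPerturbed

namespace IsQuadraticallyPerturbed

variable {c₁ c₂ K₁ K₂ κ₁ κ₂ : ℝ} {a a₁ b b₁ n₁ n₂ : ℝ → ℝ}

lemma exists_bound_error (h : IsQuadraticallyPerturbed c₁ c₂ K₁ K₂ κ₁ κ₂ a a₁ b b₁ n₁ n₂)
    (x y : ℝ) : ∃ C, 0 < C ∧ ∀ᶠ t in atTop, |x * n₁ t + y * n₂ t| ≤ C * (a t ^ 2 + b t ^ 2) := by
  obtain ⟨C, hC, hev⟩ := h.error
  refine ⟨(|x| + |y|) * C + 1, by positivity, ?_⟩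
  filter_upwards [hev] with t ⟨h1, h2⟩
  have h3 : 0 ≤ a t ^ 2 + b t ^ 2 := by positivity
  calc |x * n₁ t + y * n₂ t| ≤ |x| * |n₁ t| + |y| * |n₂ t| := by
        rw [← abs_mul, ← abs_mul]; exact abs_add_le _ _
    _ ≤ |x| * (C * (a t ^ 2 + b t ^ 2)) + |y| * (C * (a t ^ 2 + b t ^ 2)) := by gcongr
    _ ≤ _ := by nlinarith

lemma exists_bound_eigenFunctional
    (h : IsQuadraticallyPerturbed c₁ c₂ K₁ K₂ κ₁ κ₂ a a₁ b b₁ n₁ n₂) (l : ℝ) :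
    ∃ M, ∀ t, 0 ≤ t → |eigenFunctional c₁ c₂ K₁ κ₂ l (a t) (a₁ t) (b t) (b₁ t)| ≤ M := by
  obtain ⟨M₁, h1⟩ := h.bdd_a₁
  obtain ⟨M₂, h2⟩ := h.bdd_b₁
  refine ⟨|κ₂| * (M₁ + |l + c₁| * a 0) + |K₁ - c₁ * l - l ^ 2| * (M₂ + |l + c₂| * b 0),
    fun t ht => ?_⟩
  have ha : |a t| ≤ a 0 := by rw [abs_of_pos (h.pos_a t)]; exact h.anti_a ht
  have hb : |b t| ≤ b 0 := by rw [abs_of_pos (h.pos_b t)]; exact h.anti_b ht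
  unfold eigenFunctional
  refine (abs_add_le _ _).trans ?_
  rw [abs_mul, abs_mul]
  gcongr
  · refine (abs_add_le _ _).trans ?_
    rw [abs_mul]
    gcongr
    exact h1 t
  · refine (abs_add_le _ _).trans ?_
    rw [abs_mul]
    gcongr
    exact h2 t

/-- The unstable component is quadratically small. -/
lemma exists_bound_unstable (h : IsQuadraticallyPerturbed c₁ c₂ K₁ K₂ κ₁ κ₂ a a₁ b b₁ n₁ n₂)
    {l : ℝ} (hl0 : 0 < l) (hl : (K₁ - c₁ * l - l ^ 2) * (K₂ - c₂ * l - l ^ 2) = κ₁ * κ₂) :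
    ∃ C, 0 < C ∧ ∀ᶠ t in atTop,
      |eigenFunctional c₁ c₂ K₁ κ₂ l (a t) (a₁ t) (b t) (b₁ t)| ≤ C * (a t ^ 2 + b t ^ 2) := by
  obtain ⟨C, hC, hev⟩ := h.exists_bound_error κ₂ (K₁ - c₁ * l - l ^ 2)
  obtain ⟨M, hM⟩ := h.exists_bound_eigenFunctional l
  obtain ⟨T, hT⟩ := eventually_atTop.1 hev
  refine ⟨C / l, by positivity, ?_⟩
  filter_upwards [eventually_ge_atTop T, eventually_ge_atTop 0] with t ht ht0
  -- As `a` and `b` decrease, the forcing on all of `[t, ∞)` is bounded by its bound at `t`.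
  have h1 := abs_le_of_unstable (T := t) (M := M) (K := C * (a t ^ 2 + b t ^ 2)) hl0
    (h.hasDerivAt_eigenFunctional hl) (fun s hs => hM s (ht0.trans hs)) (fun s hs => by
      refine (hT s (ht.trans hs)).trans ?_
      have := h.anti_a hs
      have := h.anti_b hs
      have := h.pos_a s
      have := h.pos_b s
      gcongr)
  calc _ ≤ _ := h1
    _ = _ := by ring

lemma eventually_sq_add_sq_le (h : IsQuadraticallyPerturbed c₁ c₂ K₁ K₂ κ₁ κ₂ a a₁ b b₁ n₁ n₂)
    {η : ℝ} (hη : 0 < η) : ∀ᶠ t in atTop, a t ^ 2 + b t ^ 2 ≤ η * (a t + b t) := by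
  filter_upwards [h.tendsto_a.eventually (gt_mem_nhds hη),
    h.tendsto_b.eventually (gt_mem_nhds hη)] with t h1 h2
  nlinarith [h.pos_a t, h.pos_b t]

/-- Asymptotic expansion at `+∞`, when the characteristic roots are
`l₄ < l₃ ≤ -γ < 0 < l₁`. -/
lemma exists_tendsto (h : IsQuadraticallyPerturbed c₁ c₂ K₁ K₂ κ₁ κ₂ a a₁ b b₁ n₁ n₂)
    {γ l₁ l₃ l₄ : ℝ} (hκ : κ₂ ≠ 0) (hγ : 0 < γ) (h1 : 0 < l₁) (h3 : l₃ ≤ -γ) (h4 : l₄ < l₃)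
    (hl₁ : (K₁ - c₁ * l₁ - l₁ ^ 2) * (K₂ - c₂ * l₁ - l₁ ^ 2) = κ₁ * κ₂)
    (hl₂ : (K₁ - c₁ * (-γ) - (-γ) ^ 2) * (K₂ - c₂ * (-γ) - (-γ) ^ 2) = κ₁ * κ₂)
    (hl₄ : (K₁ - c₁ * l₄ - l₄ ^ 2) * (K₂ - c₂ * l₄ - l₄ ^ 2) = κ₁ * κ₂)
    (hl₃ : (c₁ + -γ + l₃) * (K₂ - c₂ * (-γ) - (-γ) ^ 2)
      + (K₁ - c₁ * l₃ - l₃ ^ 2) * (c₂ + -γ + l₃) = 0) :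
    (l₃ < -γ → ∃ A B, Tendsto (fun t => Real.exp (γ * t) * a t) atTop (𝓝 A) ∧
      Tendsto (fun t => Real.exp (γ * t) * b t) atTop (𝓝 B)) ∧
    (l₃ = -γ → ∃ A B, Tendsto (fun t => Real.exp (γ * t) * a t / t) atTop (𝓝 A) ∧
      Tendsto (fun t => Real.exp (γ * t) * b t / t) atTop (𝓝 B)) := by
  obtain ⟨x₁, x₂, x₃, x₄, y₁, y₂, y₃, y₄, hxy⟩ := exists_coeffs_eigenFunctional
    (c₁ := c₁) (c₂ := c₂) (K₁ := K₁) (l₁ := l₁) (l₂ := -γ) (l₃ := l₃) (l₄ := l₄) hκ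
    (by linarith) (by linarith) (by linarith) (by linarith) (by linarith)
  have dU := h.hasDerivAt_eigenFunctional hl₁
  have dZ := h.hasDerivAt_eigenFunctional hl₂
  have dV := h.hasDerivAt_eigenFunctionalDiff hl₃
  have dW := h.hasDerivAt_eigenFunctional hl₄
  obtain ⟨CU, hCU, hU⟩ := h.exists_bound_unstable h1 hl₁
  obtain ⟨CZ, hCZ, hnZ⟩ := h.exists_bound_error κ₂ (K₁ - c₁ * (-γ) - (-γ) ^ 2)
  obtain ⟨CV, hCV, hnV⟩ := h.exists_bound_error 0 (-(c₁ + -γ + l₃))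
  obtain ⟨CW, hCW, hnW⟩ := h.exists_bound_error κ₂ (K₁ - c₁ * l₄ - l₄ ^ 2)
  have hab := fun t => hxy (a t) (a₁ t) (b t) (b₁ t)
  simp only [zero_mul, zero_add] at hnV
  set U := fun t => eigenFunctional c₁ c₂ K₁ κ₂ l₁ (a t) (a₁ t) (b t) (b₁ t) with hUd
  set Z := fun t => eigenFunctional c₁ c₂ K₁ κ₂ (-γ) (a t) (a₁ t) (b t) (b₁ t) with hZd
  set V := fun t => eigenFunctionalDiff c₁ c₂ K₁ κ₂ (-γ) l₃ (a t) (b t) (b₁ t) with hVd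
  set W := fun t => eigenFunctional c₁ c₂ K₁ κ₂ l₄ (a t) (a₁ t) (b t) (b₁ t) with hWd
  set nZ := fun t => κ₂ * n₁ t + (K₁ - c₁ * (-γ) - (-γ) ^ 2) * n₂ t with hnZd
  set nV := fun t => -(c₁ + -γ + l₃) * n₂ t with hnVd
  set nW := fun t => κ₂ * n₁ t + (K₁ - c₁ * l₄ - l₄ ^ 2) * n₂ t with hnWd
  change ∀ t, HasDerivAt Z (-γ * Z t + nZ t) t at dZ
  change ∀ t, HasDerivAt V (l₃ * V t + Z t + nV t) t at dV
  change ∀ t, HasDerivAt W (l₄ * W t + nW t) t at dW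
  change ∀ᶠ t in atTop, |U t| ≤ CU * (a t ^ 2 + b t ^ 2) at hU
  change ∀ᶠ t in atTop, |nZ t| ≤ CZ * (a t ^ 2 + b t ^ 2) at hnZ
  change ∀ᶠ t in atTop, |nV t| ≤ CV * (a t ^ 2 + b t ^ 2) at hnV
  change ∀ᶠ t in atTop, |nW t| ≤ CW * (a t ^ 2 + b t ^ 2) at hnW
  have hab : ∀ t, a t = x₁ * U t + x₂ * Z t + x₃ * V t + x₄ * W t ∧
    b t = y₁ * U t + y₂ * Z t + y₃ * V t + y₄ * W t := hab
  clear_value U Z V W nZ nV nW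
  obtain ⟨R, hR, hRab⟩ : ∃ R, 0 < R ∧
      ∀ t, a t + b t ≤ R * (|U t| + (|Z t| + |V t| + |W t|)) := by
    refine ⟨(|x₁| + |x₂| + |x₃| + |x₄| + |y₁| + |y₂| + |y₃| + |y₄|) + 1, by positivity,
      fun t => ?_⟩
    have hm : ∀ x y r : ℝ, |x| ≤ r → x * y ≤ r * |y| := fun x y r hr =>
      (le_abs_self _).trans (by rw [abs_mul]; gcongr)
    rw [(hab t).1, (hab t).2]
    set R := (|x₁| + |x₂| + |x₃| + |x₄| + |y₁| + |y₂| + |y₃| + |y₄|) + 1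
    have e1 := hm (x₁ + y₁) (U t) R (by
      refine (abs_add_le _ _).trans ?_
      have := abs_nonneg x₂; have := abs_nonneg x₃; have := abs_nonneg x₄
      have := abs_nonneg y₂; have := abs_nonneg y₃; have := abs_nonneg y₄
      linarith)
    have e2 := hm (x₂ + y₂) (Z t) R (by
      refine (abs_add_le _ _).trans ?_
      have := abs_nonneg x₁; have := abs_nonneg x₃; have := abs_nonneg x₄
      have := abs_nonneg y₁; have := abs_nonneg y₃; have := abs_nonneg y₄
      linarith)
    have e3 := hm (x₃ + y₃) (V t) R (by
      refine (abs_add_le _ _).trans ?_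
      have := abs_nonneg x₁; have := abs_nonneg x₂; have := abs_nonneg x₄
      have := abs_nonneg y₁; have := abs_nonneg y₂; have := abs_nonneg y₄
      linarith)
    have e4 := hm (x₄ + y₄) (W t) R (by
      refine (abs_add_le _ _).trans ?_
      have := abs_nonneg x₁; have := abs_nonneg x₂; have := abs_nonneg x₃
      have := abs_nonneg y₁; have := abs_nonneg y₂; have := abs_nonneg y₃
      linarith)
    linarith
  -- The unstable component is quadratic in `(a, b)`, hence eventually absorbed into half of the
  -- left-hand side.
  have habs : ∀ᶠ t in atTop, a t + b t ≤ 2 * R * (|Z t| + |V t| + |W t|) := by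
    filter_upwards [hU, h.eventually_sq_add_sq_le (η := 1 / (2 * R * CU)) (by positivity)]
      with t hu hsq
    have e1 : R * |U t| ≤ (a t + b t) / 2 := by
      calc R * |U t| ≤ R * (CU * (1 / (2 * R * CU) * (a t + b t))) := by
            gcongr; exact hu.trans (by gcongr)
        _ = _ := by field_simp
    linarith [hRab t]
  have hsmall : ∀ C, 0 < C → ∀ ν > 0, ∀ᶠ t in atTop,
      C * (a t ^ 2 + b t ^ 2) ≤ ν * (|Z t| + |V t| + |W t|) := by
    intro C hC ν hν
    filter_upwards [habs, h.eventually_sq_add_sq_le (η := ν / (2 * R * C)) (by positivity)]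
      with t ht hsq
    calc _ ≤ C * (ν / (2 * R * C) * (2 * R * (|Z t| + |V t| + |W t|))) := by
          gcongr; exact hsq.trans (by gcongr)
      _ = _ := by field_simp
  obtain ⟨C, hC, hdec⟩ := triangular_decay hγ h3 (h4.le.trans h3) dZ dV dW (by
    intro ν hν
    filter_upwards [hnZ, hnV, hnW, hsmall CZ hCZ ν hν, hsmall CV hCV ν hν, hsmall CW hCW ν hν]
      with t e1 e2 e3 e4 e5 e6
    exact ⟨e1.trans e4, e2.trans e5, e3.trans e6⟩)
  have hexp : ∀ t : ℝ, Real.exp (γ * t) * Real.exp (-(3 / 2 * γ) * t)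
      = Real.exp (-(γ / 2) * t) := fun t => by rw [← Real.exp_add]; ring_nf
  -- Quadratic terms decay like `e^{-3γt/2}`, so they remain exponentially small after
  -- multiplication by `e^{γt}`.
  have hG : ∀ D, 0 < D → ∀ f : ℝ → ℝ, (∀ᶠ t in atTop, |f t| ≤ D * (a t ^ 2 + b t ^ 2)) →
      ∀ᶠ t in atTop, |Real.exp (γ * t) * f t|
        ≤ D * ((2 * R) ^ 2 * C) * Real.exp (-(γ / 2) * t) := by
    intro D hD f hf
    filter_upwards [hf, habs, hdec] with t e1 e2 e3
    have e4 : a t ^ 2 + b t ^ 2 ≤ (2 * R) ^ 2 * (C * Real.exp (-(3 / 2 * γ) * t)) := by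
      calc a t ^ 2 + b t ^ 2 ≤ (a t + b t) ^ 2 := by
            nlinarith [mul_pos (h.pos_a t) (h.pos_b t)]
        _ ≤ (2 * R * (|Z t| + |V t| + |W t|)) ^ 2 :=
            pow_le_pow_left₀ (add_pos (h.pos_a t) (h.pos_b t)).le e2 2
        _ = (2 * R) ^ 2 * (|Z t| + |V t| + |W t|) ^ 2 := by ring
        _ ≤ _ := by gcongr
    rw [abs_mul, abs_of_pos (Real.exp_pos _), ← hexp t]
    calc _ ≤ Real.exp (γ * t) * (D * ((2 * R) ^ 2 * (C * Real.exp (-(3 / 2 * γ) * t)))) := by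
          gcongr; exact e1.trans (by gcongr)
      _ = _ := by ring
  have hG0 : ∀ D, 0 < D → ∀ f : ℝ → ℝ, (∀ᶠ t in atTop, |f t| ≤ D * (a t ^ 2 + b t ^ 2)) →
      Tendsto (fun t => Real.exp (γ * t) * f t) atTop (𝓝 0) := by
    intro D hD f hf
    have e := (tendsto_exp_neg_mul_atTop (half_pos hγ)).const_mul (D * ((2 * R) ^ 2 * C))
    rw [mul_zero] at e
    exact squeeze_zero_norm' (hG D hD f hf) e
  have hU0 := hG0 CU hCU U hU
  have dζ : ∀ {f g : ℝ → ℝ} {l : ℝ}, (∀ t, HasDerivAt f (l * f t + g t) t) → ∀ t,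
      HasDerivAt (fun t => Real.exp (γ * t) * f t)
        (-(-γ - l) * (Real.exp (γ * t) * f t) + Real.exp (γ * t) * g t) t := by
    intro f g l hf t
    exact ((hasDerivAt_exp_const_mul γ t).mul (hf t)).congr_deriv (by ring)
  obtain ⟨D, hD⟩ := exists_tendsto_of_deriv_exp_small
    (f := fun t => Real.exp (γ * t) * Z t) (g := fun t => Real.exp (γ * t) * nZ t)
    (fun t => (dζ dZ t).congr_deriv (by ring)) (half_pos hγ) (hG CZ hCZ nZ hnZ)
  have hW0 : Tendsto (fun t => Real.exp (γ * t) * W t) atTop (𝓝 0) := by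
    simpa using tendsto_of_damped (show 0 < -γ - l₄ by linarith) (dζ dW) (hG0 CW hCW nW hnW)
  have hforce : Tendsto (fun t => Real.exp (γ * t) * (Z t + nV t)) atTop (𝓝 D) := by
    have := hD.add (hG0 CV hCV nV hnV)
    simpa only [mul_add, add_zero] using this
  have dV' : ∀ t, HasDerivAt (fun t => Real.exp (γ * t) * V t)
        (-(-γ - l₃) * (Real.exp (γ * t) * V t) + Real.exp (γ * t) * (Z t + nV t)) t :=
    dζ fun t => (dV t).congr_deriv (by ring)
  constructor
  · intro hlt
    have hV := tendsto_of_damped (show 0 < -γ - l₃ by linarith) dV' hforce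
    refine ⟨_, _, ((((hU0.const_mul x₁).add (hD.const_mul x₂)).add (hV.const_mul x₃)).add
      (hW0.const_mul x₄)).congr fun t => ?_, ((((hU0.const_mul y₁).add (hD.const_mul y₂)).add
      (hV.const_mul y₃)).add (hW0.const_mul y₄)).congr fun t => ?_⟩
    · rw [(hab t).1]; ring
    · rw [(hab t).2]; ring
  · intro heq
    -- At a double root the damping of `e^{γt} V` vanishes, and the forcing with limit `D` makes it
    -- grow like `D t`.
    have hV := tendsto_div_id_of_tendsto_deriv (f := fun t => Real.exp (γ * t) * V t)
      (g := fun t => Real.exp (γ * t) * (Z t + nV t))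
      (fun t => (dV' t).congr_deriv (by rw [heq]; ring)) hforce
    have hU1 := hU0.div_atTop tendsto_id
    have hD1 := hD.div_atTop tendsto_id
    have hW1 := hW0.div_atTop tendsto_id
    refine ⟨_, _, ((((hU1.const_mul x₁).add (hD1.const_mul x₂)).add (hV.const_mul x₃)).add
      (hW1.const_mul x₄)).congr fun t => ?_, ((((hU1.const_mul y₁).add (hD1.const_mul y₂)).add
      (hV.const_mul y₃)).add (hW1.const_mul y₄)).congr fun t => ?_⟩
    · rw [(hab t).1]; simp only [id]; ring
    · rw [(hab t).2]; simp only [id]; ring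

end IsQuadraticallyPerturbed

/-! ### Linearisation at the singular solution and its characteristic roots -/

lemma abs_one_sub_rpow_sub_le {p x : ℝ} (hp : 1 ≤ p) (hx : 0 ≤ x) (hx1 : x ≤ 1)
    (hpx : p * x ≤ 1) : |(1 - x) ^ p - 1 + p * x| ≤ p ^ 2 * x ^ 2 := by
  have h1 : 0 ≤ (1 - x) ^ p - 1 + p * x := by
    have := one_add_mul_self_le_rpow_one_add (s := -x) (by linarith) hp
    rw [← sub_eq_add_neg] at this
    linarith
  -- The lower bound is Bernoulli's; the upper one comes from the second-order bound for the
  -- exponential.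
  have h2 : (1 - x) ^ p ≤ Real.exp (-(p * x)) := by
    have h3 : 1 - x ≤ Real.exp (-x) := by linarith [Real.add_one_le_exp (-x)]
    calc (1 - x) ^ p ≤ Real.exp (-x) ^ p :=
          Real.rpow_le_rpow (by linarith) h3 (by linarith)
      _ = _ := by rw [← Real.exp_mul]; ring_nf
  have h4 : 0 ≤ p * x := by positivity
  have h5 := (abs_le.1 (Real.abs_exp_sub_one_sub_id_le (x := -(p * x))
    (by rw [abs_neg, abs_of_nonneg h4]; exact hpx))).2
  rw [abs_of_nonneg h1]
  nlinarith

namespace IsEmdenFowler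

variable {N α β p q : ℝ} {X Y X₁ Y₁ : ℝ → ℝ}

lemma eventually_error_le (h : IsEmdenFowler N α β p q X Y X₁ Y₁) (hs : Supercritical N α β p q) :
    ∀ᶠ t in atTop, |α * (N - α) * (Y t ^ p - 1 + p * (1 - Y t))|
      ≤ α * (N - α) * p ^ 2 * ((1 - X t) ^ 2 + (1 - Y t) ^ 2) := by
  have hlim := ((h.tendsto_Y_one hs).const_sub 1).const_mul p
  rw [sub_self, mul_zero] at hlim
  filter_upwards [hlim.eventually (gt_mem_nhds one_pos)] with t ht
  have h1 := abs_one_sub_rpow_sub_le (x := 1 - Y t) hs.one_le_p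
    (by linarith [h.Y_lt_one hs t]) (by linarith [h.pos_Y t]) ht.le
  rw [sub_sub_cancel] at h1
  rw [abs_mul, abs_of_pos hs.Kα_pos, mul_assoc (α * (N - α))]
  refine mul_le_mul_of_nonneg_left (h1.trans ?_) hs.Kα_pos.le
  gcongr
  linarith [sq_nonneg (1 - X t)]

lemma bdd_X₁ (h : IsEmdenFowler N α β p q X Y X₁ Y₁) (hs : Supercritical N α β p q) (t : ℝ) :
    |-X₁ t| ≤ α := by
  rw [abs_neg, abs_of_pos (h.X₁_pos hs t)]
  nlinarith [h.X₁_le hs t, h.X_lt_one hs t, hs.pos_α]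

lemma isQuadraticallyPerturbed (h : IsEmdenFowler N α β p q X Y X₁ Y₁)
    (hs : Supercritical N α β p q) :
    IsQuadraticallyPerturbed (N - 2 * α) (N - 2 * β) (α * (N - α)) (β * (N - β))
      (p * (α * (N - α))) (q * (β * (N - β))) (fun t => 1 - X t) (fun t => -X₁ t)
      (fun t => 1 - Y t) (fun t => -Y₁ t)
      (fun t => α * (N - α) * (Y t ^ p - 1 + p * (1 - Y t)))
      (fun t => β * (N - β) * (X t ^ q - 1 + q * (1 - X t))) where
  deriv_a t := (h.deriv_X t).const_sub 1
  deriv_b t := (h.deriv_Y t).const_sub 1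
  deriv_a₁ t := (h.deriv_X₁ t).neg.congr_deriv (by ring)
  deriv_b₁ t := (h.deriv_Y₁ t).neg.congr_deriv (by ring)
  pos_a t := sub_pos.2 (h.X_lt_one hs t)
  pos_b t := sub_pos.2 (h.Y_lt_one hs t)
  anti_a := fun _ _ hst => sub_le_sub_left ((h.strictMono_X hs).monotone hst) 1
  anti_b := fun _ _ hst => sub_le_sub_left ((h.symm.strictMono_X hs.symm).monotone hst) 1
  tendsto_a := by simpa using (h.tendsto_X_one hs).const_sub 1
  tendsto_b := by simpa using (h.tendsto_Y_one hs).const_sub 1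
  bdd_a₁ := ⟨α, h.bdd_X₁ hs⟩
  bdd_b₁ := ⟨β, h.symm.bdd_X₁ hs.symm⟩
  error := by
    refine ⟨α * (N - α) * p ^ 2 + β * (N - β) * q ^ 2, ?_, ?_⟩
    · have := hs.Kα_pos
      have := hs.Kβ_pos
      positivity
    · filter_upwards [h.eventually_error_le hs, h.symm.eventually_error_le hs.symm] with t h1 h2
      have h3 : 0 ≤ (1 - X t) ^ 2 + (1 - Y t) ^ 2 := by positivity
      have h4 : 0 ≤ α * (N - α) * p ^ 2 := mul_nonneg hs.Kα_pos.le (sq_nonneg p)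
      have h5 : 0 ≤ β * (N - β) * q ^ 2 := mul_nonneg hs.Kβ_pos.le (sq_nonneg q)
      constructor <;> nlinarith

end IsEmdenFowler

/-- Roots of the characteristic polynomial. -/
lemma Supercritical.exists_roots {N α β p q : ℝ} (h : Supercritical N α β p q) :
    ∃ μ₁ μ₂ : ℝ, 0 ≤ μ₁ ∧ μ₁ < (N - α - β) / 2 ∧ (N - α - β) / 2 < μ₂ ∧
      (∀ l, (α - l) * (N - (α - l)) * ((β - l) * (N - (β - l)))
          - p * q * (α * (N - α)) * (β * (N - β))
        = ((l + (N - α - β) / 2) ^ 2 - μ₁ ^ 2) * ((l + (N - α - β) / 2) ^ 2 - μ₂ ^ 2)) ∧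
      (p * q * (α * (N - α)) * (β * (N - β)) < ((N ^ 2 - (α - β) ^ 2) / 4) ^ 2 → 0 < μ₁) ∧
      (p * q * (α * (N - α)) * (β * (N - β)) = ((N ^ 2 - (α - β) ^ 2) / 4) ^ 2 → μ₁ = 0) := by
  set J := p * q * (α * (N - α)) * (β * (N - β)) with hJ
  have hJ0 : 0 < J := by
    have := h.Kα_pos
    have := h.Kβ_pos
    have := h.p_pos
    have := h.q_pos
    positivity
  set H := (N ^ 2 - (α - β) ^ 2) / 4 with hH
  have hJL : J ≤ H ^ 2 := h.jl
  set S := (N ^ 2 + (α - β) ^ 2) / 4 with hS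
  have hS0 : 0 ≤ S := by positivity
  set D := S ^ 2 - H ^ 2 + J with hD
  have hSH : S ^ 2 - H ^ 2 = N ^ 2 * (α - β) ^ 2 / 4 := by rw [hS, hH]; ring
  have hD0 : 0 < D := by
    have : 0 ≤ N ^ 2 * (α - β) ^ 2 / 4 := by positivity
    linarith
  have hsD : 0 < √D := Real.sqrt_pos.2 hD0
  have hsq : √D ^ 2 = D := Real.sq_sqrt hD0.le
  have hz1 : 0 ≤ S - √D := by
    rw [sub_nonneg, Real.sqrt_le_left hS0]
    linarith
  have hz2 : 0 ≤ S + √D := by positivity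
  set s := (N - α - β) / 2 with hs
  have hs0 : 0 < s := by linarith [h.add_lt]
  have hF : ∀ l, (α - l) * (N - (α - l)) * ((β - l) * (N - (β - l))) - J
      = ((l + s) ^ 2 - √(S - √D) ^ 2) * ((l + s) ^ 2 - √(S + √D) ^ 2) := by
    intro l
    rw [Real.sq_sqrt hz1, Real.sq_sqrt hz2]
    have e1 : ((l + s) ^ 2 - (S - √D)) * ((l + s) ^ 2 - (S + √D)) = ((l + s) ^ 2 - S) ^ 2 - D := by
      linear_combination (-1 : ℝ) * hsq
    rw [e1, hD, hS, hH, hs]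
    ring
  -- The value of the quartic at `l = 0` is negative because `p q > 1`, which places `s²` strictly
  -- between `μ₁²` and `μ₂²`.
  have h0 := hF 0
  rw [sub_zero, sub_zero, zero_add] at h0
  have hneg : α * (N - α) * (β * (N - β)) - J < 0 := by
    have := mul_pos h.Kα_pos h.Kβ_pos
    have := h.one_lt_mul
    rw [hJ]
    nlinarith
  rw [h0, Real.sq_sqrt hz1, Real.sq_sqrt hz2] at hneg
  have hlt1 : S - √D < s ^ 2 := by
    by_contra! hc
    nlinarith
  have hlt2 : s ^ 2 < S + √D := by
    by_contra! hc
    nlinarith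
  refine ⟨√(S - √D), √(S + √D), Real.sqrt_nonneg _, (Real.sqrt_lt' hs0).2 hlt1,
    (Real.lt_sqrt hs0.le).2 hlt2, hF, fun hlt => Real.sqrt_pos.2 ?_, fun heq => ?_⟩
  · rw [sub_pos, Real.sqrt_lt' (by nlinarith)]
    linarith
  · have : D = S ^ 2 := by rw [hD, heq]; ring
    rw [this, Real.sqrt_sq hS0, sub_self, Real.sqrt_zero]

/-- Convergence rate of a regular solution towards the singular one, in the Emden-Fowler
variables. -/
lemma IsEmdenFowler.exists_tendsto {N α β p q : ℝ} {X Y X₁ Y₁ : ℝ → ℝ}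
    (h : IsEmdenFowler N α β p q X Y X₁ Y₁) (hs : Supercritical N α β p q) {μ₁ μ₂ : ℝ}
    (h0 : 0 ≤ μ₁) (h1 : μ₁ < (N - α - β) / 2) (h2 : (N - α - β) / 2 < μ₂)
    (hF : ∀ l, (α - l) * (N - (α - l)) * ((β - l) * (N - (β - l)))
          - p * q * (α * (N - α)) * (β * (N - β))
        = ((l + (N - α - β) / 2) ^ 2 - μ₁ ^ 2) * ((l + (N - α - β) / 2) ^ 2 - μ₂ ^ 2)) :
    (0 < μ₁ → ∃ A B,
      Tendsto (fun t => Real.exp (((N - α - β) / 2 - μ₁) * t) * (1 - X t)) atTop (𝓝 A) ∧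
      Tendsto (fun t => Real.exp (((N - α - β) / 2 - μ₁) * t) * (1 - Y t)) atTop (𝓝 B)) ∧
    (μ₁ = 0 → ∃ A B,
      Tendsto (fun t => Real.exp (((N - α - β) / 2 - μ₁) * t) * (1 - X t) / t) atTop (𝓝 A) ∧
      Tendsto (fun t => Real.exp (((N - α - β) / 2 - μ₁) * t) * (1 - Y t) / t) atTop (𝓝 B)) := by
  set s := (N - α - β) / 2 with hsd
  have hroot : ∀ l, ((l + s) ^ 2 - μ₁ ^ 2) * ((l + s) ^ 2 - μ₂ ^ 2) = 0 →
      (α * (N - α) - (N - 2 * α) * l - l ^ 2) * (β * (N - β) - (N - 2 * β) * l - l ^ 2)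
        = p * (α * (N - α)) * (q * (β * (N - β))) := fun l hl => by
    linear_combination hF l + hl
  obtain ⟨hA, hB⟩ := (h.isQuadraticallyPerturbed hs).exists_tendsto (γ := s - μ₁)
    (l₁ := μ₂ - s) (l₃ := -s - μ₁) (l₄ := -s - μ₂) (mul_pos hs.q_pos hs.Kβ_pos).ne'
    (by linarith) (by linarith) (by linarith) (by linarith) (hroot _ (by ring))
    (hroot _ (by ring)) (hroot _ (by ring)) (by rw [hsd]; ring)
  exact ⟨fun hμ => hA (by linarith), fun hμ => hB (by linarith)⟩

/-! ### Passage between the original and the Emden-Fowler variables -/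

/-- The Emden-Fowler change of variables for one equation. -/
lemma emdenFowler_change {N k p α β C C' : ℝ} {u u₁ u₂ v : ℝ → ℝ} (hα : 0 < α)
    (hC : 0 < C) (hC' : 0 < C') (hCC : C' ^ p = α * (N - α) * C) (hK : 0 < α * (N - α))
    (hαβ : β * p = α + 2 + k)
    (hu : ∀ r, 0 < r → HasDerivAt u (u₁ r) r) (hu₁ : ∀ r, 0 < r → HasDerivAt u₁ (u₂ r) r)
    (heq : ∀ r, 0 < r → -(u₂ r + (N + 1) / r * u₁ r) = r ^ k * v r ^ p)
    (hu0 : 0 < u 0) (hv : ∀ r, 0 < r → 0 < v r)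
    (hlim : Tendsto u (𝓝[>] 0) (𝓝 (u 0))) (hlim₁ : Tendsto (fun r => r * u₁ r) (𝓝[>] 0) (𝓝 0)) :
    let X := fun t => Real.exp (α * t) * u (Real.exp t) / C
    let Y := fun t => Real.exp (β * t) * v (Real.exp t) / C'
    let X₁ := fun t => Real.exp (α * t) * (α * u (Real.exp t) + Real.exp t * u₁ (Real.exp t)) / C
    (∀ t, HasDerivAt X (X₁ t) t) ∧
    (∀ t, HasDerivAt X₁ (-(N - 2 * α) * X₁ t + α * (N - α) * (X t - Y t ^ p)) t) ∧
    Tendsto X atBot (𝓝 0) ∧ Tendsto X₁ atBot (𝓝 0) ∧ ∀ᶠ t in atBot, 0 < X₁ t := by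
  intro X Y X₁
  have hexp : Tendsto Real.exp atBot (𝓝[>] 0) := Real.tendsto_exp_atBot_nhdsGT
  have hexpα : Tendsto (fun t : ℝ => Real.exp (α * t)) atBot (𝓝 0) :=
    Real.tendsto_exp_atBot.comp (tendsto_id.const_mul_atBot hα)
  have hdu : ∀ t, HasDerivAt (fun t => u (Real.exp t)) (u₁ (Real.exp t) * Real.exp t) t :=
    fun t => (hu _ (Real.exp_pos t)).comp t (Real.hasDerivAt_exp t)
  have hdu₁ : ∀ t, HasDerivAt (fun t => u₁ (Real.exp t)) (u₂ (Real.exp t) * Real.exp t) t :=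
    fun t => (hu₁ _ (Real.exp_pos t)).comp t (Real.hasDerivAt_exp t)
  have hw : Tendsto (fun t => α * u (Real.exp t) + Real.exp t * u₁ (Real.exp t)) atBot
      (𝓝 (α * u 0)) := by
    simpa using ((hlim.comp hexp).const_mul α).add (hlim₁.comp hexp)
  refine ⟨fun t => ?_, fun t => ?_, ?_, ?_, ?_⟩
  · refine (((hasDerivAt_exp_const_mul α t).mul (hdu t)).div_const C).congr_deriv ?_
    simp only [X₁]
    ring
  · refine (((hasDerivAt_exp_const_mul α t).mul (((hdu t).const_mul α).add
      ((Real.hasDerivAt_exp t).mul (hdu₁ t)))).div_const C).congr_deriv ?_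
    have hr := Real.exp_pos t
    have h1 := heq _ hr
    have hvr := hv _ hr
    -- The scaling relation `β p = α + 2 + k` matches the powers of `r`, which makes the system
    -- autonomous; `hCC` normalises the constants.
    have hY : Y t ^ p = Real.exp (α * t) * Real.exp t ^ 2 * Real.exp t ^ k * v (Real.exp t) ^ p
        / (α * (N - α) * C) := by
      simp only [Y]
      rw [Real.div_rpow (by positivity) hC'.le, Real.mul_rpow (by positivity) hvr.le, hCC,
        ← Real.exp_mul]
      congr 2
      rw [← Real.exp_mul, ← Real.exp_nat_mul, ← Real.exp_add, ← Real.exp_add]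
      congr 1
      push_cast
      linear_combination t * hαβ
    have hY' : α * (N - α) * Y t ^ p = Real.exp (α * t) * Real.exp t ^ 2 *
        (Real.exp t ^ k * v (Real.exp t) ^ p) / C := by
      rw [hY, mul_assoc (Real.exp (α * t) * Real.exp t ^ 2), mul_div_assoc',
        mul_div_mul_left _ _ hK.ne']
    rw [mul_sub, hY', ← h1]
    simp only [X, X₁, Pi.add_apply, Pi.mul_apply]
    field_simp
    ring
  · have := (hexpα.mul (hlim.comp hexp)).div_const C
    rw [zero_mul, zero_div] at this
    exact this
  · have := (hexpα.mul hw).div_const C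
    rw [zero_mul, zero_div] at this
    exact this
  · filter_upwards [hw.eventually (lt_mem_nhds (mul_pos hα hu0))] with t ht
    simp only [X₁]
    positivity

/-- With `x = Q(α)` and `y = Q(β)` this is `C_β^p = Q(α) C_α`, the algebraic form of the singular
solution being a solution. -/
lemma rpow_normalisation {x y p q : ℝ} (hx : 0 < x) (hy : 0 < y) (hpq : 1 < p * q) :
    ((y * x ^ q) ^ (1 / (p * q - 1))) ^ p = x * (x * y ^ p) ^ (1 / (p * q - 1)) := by
  have hd : p * q - 1 ≠ 0 := by linarith
  have hyp := Real.rpow_pos_of_pos hy p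
  have hxq := Real.rpow_pos_of_pos hx q
  rw [← Real.rpow_mul (by positivity), Real.mul_rpow hy.le hxq.le, Real.mul_rpow hx.le hyp.le,
    ← Real.rpow_mul hx.le, ← Real.rpow_mul hy.le, ← mul_assoc]
  have h1 : x * x ^ (1 / (p * q - 1)) = x ^ (q * (1 / (p * q - 1) * p)) := by
    nth_rewrite 1 [← Real.rpow_one x]
    rw [← Real.rpow_add hx]
    congr 1
    field_simp
    ring
  rw [← mul_assoc x, h1, mul_comm]
  congr 2 <;> ring

lemma sub_expansion_eq {u : ℝ → ℝ} {C A α γ r : ℝ} (hC : C ≠ 0) (hr : 0 < r) :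
    u r - (C * r ^ (-α) + -(C * A) * r ^ (-α - γ)) = -C * (Real.exp (γ * Real.log r) *
      (1 - Real.exp (α * Real.log r) * u (Real.exp (Real.log r)) / C) - A) * r ^ (-α - γ) := by
  have h1 : Real.exp (γ * Real.log r) = r ^ γ := by
    rw [Real.rpow_def_of_pos hr, mul_comm]
  have h2 : Real.exp (α * Real.log r) = r ^ α := by
    rw [Real.rpow_def_of_pos hr, mul_comm]
  have hα := Real.rpow_pos_of_pos hr α
  have hγ := Real.rpow_pos_of_pos hr γ
  rw [h1, h2, Real.exp_log hr, Real.rpow_sub hr, Real.rpow_neg hr.le]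
  field_simp
  ring

lemma isLittleO_expansion {u : ℝ → ℝ} {C A α γ : ℝ} (hC : C ≠ 0)
    (h : Tendsto (fun t => Real.exp (γ * t) * (1 - Real.exp (α * t) * u (Real.exp t) / C))
      atTop (𝓝 A)) :
    (fun r : ℝ => u r - (C * r ^ (-α) + -(C * A) * r ^ (-α - γ)))
      =o[atTop] fun r : ℝ => r ^ (-α - γ) := by
  have h1 := ((h.comp Real.tendsto_log_atTop).sub_const A).const_mul (-C)
  rw [sub_self, mul_zero] at h1
  have h2 := ((isLittleO_one_iff ℝ).2 h1).mul_isBigO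
    (isBigO_refl (fun r : ℝ => r ^ (-α - γ)) atTop)
  simp only [one_mul] at h2
  refine h2.congr' ?_ EventuallyEq.rfl
  filter_upwards [eventually_gt_atTop 0] with r hr using (sub_expansion_eq hC hr).symm

lemma isLittleO_expansion_log {u : ℝ → ℝ} {C A α γ : ℝ} (hC : C ≠ 0)
    (h : Tendsto (fun t => Real.exp (γ * t) * (1 - Real.exp (α * t) * u (Real.exp t) / C) / t)
      atTop (𝓝 A)) :
    (fun r : ℝ => u r - (C * r ^ (-α) + -(C * A) * (r ^ (-α - γ) * Real.log r)))
      =o[atTop] fun r : ℝ => r ^ (-α - γ) * Real.log r := by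
  have h1 := ((h.comp Real.tendsto_log_atTop).sub_const A).const_mul (-C)
  rw [sub_self, mul_zero] at h1
  have h2 := ((isLittleO_one_iff ℝ).2 h1).mul_isBigO
    (isBigO_refl (fun r : ℝ => r ^ (-α - γ) * Real.log r) atTop)
  simp only [one_mul] at h2
  refine h2.congr' ?_ EventuallyEq.rfl
  filter_upwards [eventually_gt_atTop 1] with r hr
  have hl := Real.log_pos hr
  -- Taking `A = 0` isolates `u - C r^{-α}`; the logarithmic correction is subtracted afterwards.
  have h3 := sub_expansion_eq (u := u) (A := 0) (α := α) (γ := γ) hC (zero_lt_one.trans hr)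
  simp only [mul_zero, neg_zero, zero_mul, add_zero, sub_zero] at h3
  simp only [Function.comp_apply]
  rw [← sub_sub, h3]
  field_simp
  ring

namespace HenonLaneEmden

lemma supercritical {n : ℕ} {k l p q : ℝ} (hk : 0 ≤ k) (hl : 0 ≤ l)
    (hp : 1 ≤ p) (hq : 1 ≤ q) (hpq : 1 < p * q) (hex : ExistenceCondition n k l p q)
    (hJL : jlRight n k l p q ≤ jlLeft n k l p q) :
    Supercritical ((n : ℝ) - 2) (alpha k l p q) (beta k l p q) p q where
  pos_α := div_pos (by positivity) (by linarith)
  pos_β := div_pos (by positivity) (by linarith)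
  -- After clearing denominators, the existence condition is precisely `α + β ≤ n - 2`.
  add_le := by
    unfold ExistenceCondition at hex
    rw [div_add_div _ _ (by linarith) (by linarith),
      div_le_iff₀ (mul_pos (by linarith) (by linarith))] at hex
    unfold alpha beta
    rw [← add_div, div_le_iff₀ (by linarith)]
    linarith
  one_le_p := hp
  one_le_q := hq
  one_lt_mul := hpq
  jl := hJL

lemma beta_mul {k l p q : ℝ} (hpq : 1 < p * q) :
    beta k l p q * p = alpha k l p q + 2 + k := by
  have h : (p * q - 1) * (p * q - 1)⁻¹ = 1 := mul_inv_cancel₀ (by linarith)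
  unfold alpha beta
  rw [div_eq_mul_inv, div_eq_mul_inv]
  linear_combination (k + 2) * h

lemma alpha_mul {k l p q : ℝ} (hpq : 1 < p * q) :
    alpha k l p q * q = beta k l p q + 2 + l := by
  have h : (p * q - 1) * (p * q - 1)⁻¹ = 1 := mul_inv_cancel₀ (by linarith)
  unfold alpha beta
  rw [div_eq_mul_inv, div_eq_mul_inv]
  linear_combination (l + 2) * h

/-- A regular positive radial solution gives rise to a solution of the autonomous system. -/
lemma exists_isEmdenFowler {n : ℕ} (hn : 0 < n) {k l p q : ℝ} (hpq : 1 < p * q)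
    (hs : Supercritical ((n : ℝ) - 2) (alpha k l p q) (beta k l p q) p q)
    (hCα : 0 < Calpha n k l p q) (hCβ : 0 < Cbeta n k l p q) {u v : ℝ → ℝ}
    (h : IsRegularPositiveRadialSolution n k l p q u v) :
    ∃ X₁ Y₁ : ℝ → ℝ, IsEmdenFowler ((n : ℝ) - 2) (alpha k l p q) (beta k l p q) p q
      (fun t => Real.exp (alpha k l p q * t) * u (Real.exp t) / Calpha n k l p q)
      (fun t => Real.exp (beta k l p q * t) * v (Real.exp t) / Cbeta n k l p q) X₁ Y₁ := by
  obtain ⟨u₁, u₂, e, he, hu, hu₁, hΔu, hu0, hru⟩ := exists_radial_profile_derivs hn h.contDiff_u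
  obtain ⟨v₁, v₂, e', he', hv, hv₁, hΔv, hv0, hrv⟩ := exists_radial_profile_derivs hn h.contDiff_v
  have hnorm : ∀ r : ℝ, 0 ≤ r → ∀ e : EuclideanSpace ℝ (Fin n), ‖e‖ = 1 → ‖r • e‖ = r :=
    fun r hr e he => by rw [norm_smul, he, mul_one, Real.norm_of_nonneg hr]
  have hposu : ∀ r : ℝ, 0 ≤ r → 0 < u r := fun r hr => by
    simpa only [hnorm r hr e he] using h.pos_u (r • e)
  have hposv : ∀ r : ℝ, 0 ≤ r → 0 < v r := fun r hr => by
    simpa only [hnorm r hr e he] using h.pos_v (r • e)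
  have hequ : ∀ r, 0 < r → -(u₂ r + ((n : ℝ) - 2 + 1) / r * u₁ r) = r ^ k * v r ^ p :=
    fun r hr => by
      have h1 := h.eq_u (r • e)
      rw [hΔu r hr, hnorm r hr.le e he] at h1
      rw [← h1]; ring
  have heqv : ∀ r, 0 < r → -(v₂ r + ((n : ℝ) - 2 + 1) / r * v₁ r) = r ^ l * u r ^ q :=
    fun r hr => by
      have h1 := h.eq_v (r • e')
      rw [hΔv r hr, hnorm r hr.le e' he'] at h1
      rw [← h1]; ring
  have hCC : Cbeta n k l p q ^ p
      = alpha k l p q * ((n : ℝ) - 2 - alpha k l p q) * Calpha n k l p q :=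
    rpow_normalisation hs.Kα_pos hs.Kβ_pos hpq
  have hCC' : Calpha n k l p q ^ q
      = beta k l p q * ((n : ℝ) - 2 - beta k l p q) * Cbeta n k l p q := by
    have := rpow_normalisation hs.Kβ_pos hs.Kα_pos (p := q) (q := p) (by linarith [mul_comm p q])
    rw [mul_comm q p] at this
    exact this
  obtain ⟨a1, a2, a3, a4, a5⟩ := emdenFowler_change hs.pos_α hCα hCβ hCC hs.Kα_pos
    (beta_mul hpq) hu hu₁ hequ (hposu 0 le_rfl) (fun r hr => hposv r hr.le) hu0 hru
  obtain ⟨b1, b2, b3, b4, b5⟩ := emdenFowler_change hs.pos_β hCβ hCα hCC' hs.Kβ_pos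
    (alpha_mul hpq) hv hv₁ heqv (hposv 0 le_rfl) (fun r hr => hposu r hr.le) hv0 hrv
  exact ⟨_, _, a1, b1, a2, b2,
    fun t => div_pos (mul_pos (Real.exp_pos _) (hposu _ (Real.exp_pos t).le)) hCα,
    fun t => div_pos (mul_pos (Real.exp_pos _) (hposv _ (Real.exp_pos t).le)) hCβ,
    a3, b3, a4, b4, a5, b5⟩

end HenonLaneEmden

theorem theorem3p1 (n : ℕ) (hn : 11 ≤ n) (k l p q : ℝ) (hk : 0 ≤ k) (hl : 0 ≤ l)
    (hp : 1 ≤ p) (hq : 1 ≤ q) (hpq : 1 < p * q)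
    (hex : ExistenceCondition n k l p q)
    (hJL : jlRight n k l p q ≤ jlLeft n k l p q) :
    ∃ γ : ℝ, 0 < γ ∧ IsGreatest {t : ℝ | t < 0 ∧ charF n k l p q t = 0} (-γ) ∧
      ∀ u v : ℝ → ℝ, IsRegularPositiveRadialSolution n k l p q u v →
        (jlRight n k l p q < jlLeft n k l p q →
          ∃ D₁ D₂ : ℝ,
            (fun r : ℝ => u r - (Calpha n k l p q * r ^ (-alpha k l p q)
                + D₁ * r ^ (-alpha k l p q - γ)))
              =o[atTop] (fun r : ℝ => r ^ (-alpha k l p q - γ)) ∧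
            (fun r : ℝ => v r - (Cbeta n k l p q * r ^ (-beta k l p q)
                + D₂ * r ^ (-beta k l p q - γ)))
              =o[atTop] (fun r : ℝ => r ^ (-beta k l p q - γ))) ∧
        (jlLeft n k l p q = jlRight n k l p q →
          ∃ D₁ D₂ : ℝ,
            (fun r : ℝ => u r - (Calpha n k l p q * r ^ (-alpha k l p q)
                + D₁ * (r ^ (-alpha k l p q - γ) * Real.log r)))
              =o[atTop] (fun r : ℝ => r ^ (-alpha k l p q - γ) * Real.log r) ∧
            (fun r : ℝ => v r - (Cbeta n k l p q * r ^ (-beta k l p q)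
                + D₂ * (r ^ (-beta k l p q - γ) * Real.log r)))
              =o[atTop] (fun r : ℝ => r ^ (-beta k l p q - γ) * Real.log r)) := by
  have hs := supercritical hk hl hp hq hpq hex hJL
  have hQα : 0 < Q n (alpha k l p q) := hs.Kα_pos
  have hQβ : 0 < Q n (beta k l p q) := hs.Kβ_pos
  have hCα : 0 < Calpha n k l p q := by unfold Calpha; positivity
  have hCβ : 0 < Cbeta n k l p q := by unfold Cbeta; positivity
  obtain ⟨μ₁, μ₂, h0, h1, h2, hF, hlt, heq⟩ := hs.exists_roots
  set s := ((n : ℝ) - 2 - alpha k l p q - beta k l p q) / 2 with hsd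
  have hF' : ∀ t, charF n k l p q t = ((t + s) ^ 2 - μ₁ ^ 2) * ((t + s) ^ 2 - μ₂ ^ 2) := hF
  refine ⟨s - μ₁, by linarith, ⟨⟨by linarith, ?_⟩, ?_⟩, fun u v huv => ?_⟩
  · rw [hF']; ring
  · rintro t ⟨ht0, ht⟩
    rw [hF', mul_eq_zero, sub_eq_zero, sub_eq_zero, sq_eq_sq_iff_eq_or_eq_neg,
      sq_eq_sq_iff_eq_or_eq_neg] at ht
    -- The roots are `-s ± μ₁` and `-s ± μ₂` with `μ₁ < s < μ₂`: only `μ₂ - s` is positive, and `μ₁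
    -- - s` is the largest of the others.
    rcases ht with (ht | ht) | (ht | ht) <;> linarith
  · obtain ⟨X₁, Y₁, hEF⟩ := exists_isEmdenFowler (by omega) hpq hs hCα hCβ huv
    obtain ⟨hA, hB⟩ := hEF.exists_tendsto hs h0 h1 h2 hF
    constructor
    · intro hJ
      obtain ⟨A, B, hA, hB⟩ := hA (hlt hJ)
      exact ⟨_, _, isLittleO_expansion hCα.ne' hA, isLittleO_expansion hCβ.ne' hB⟩
    · intro hJ
      obtain ⟨A, B, hA, hB⟩ := hB (heq hJ.symm)
      exact ⟨_, _, isLittleO_expansion_log hCα.ne' hA, isLittleO_expansion_log hCβ.ne' hB⟩
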